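/- **Setting.** Let $n\ge 1$, $k\in\{1,n\}$, let $\Omega\subset\mathbb R^n$ be open with $0\in\Omega$, and let $f,g:\Omega\to\mathbb R^n$ be smooth with $f(0)=g(0)=0$. Consider the hyperbolically regularized conservation law $g(v)_t+f(v)_x=v_{xx}-v_{tt}$ and assume: * (A1) $Df(v)$ and $Dg(v)$ are symmetric for all $v\in\Omega$, and $Dg(0)$ is positive definite; * (A2) $Df(0)$ has $n$ real, simple eigenvalues with respect to $Dg(0)$; for $v$ near $0$, $\mu_1(v)<\dots<\mu_n(v)$ denote the eigenvalues of $Df(v)$ with respect to $Dg(v)$, i.e. $Df(v)r=\mu_j(v)Dg(v)r$ for some $r\neq0$; * (A3) $\mu_k$ is genuinely nonlinear at $0$, i.e. $D\mu_k(0)r\neq0$ for an eigenvector $r$ belonging to $\mu_k(0)$; * (A4) $Dg(0)\pm Df(0)$ are positive definite. The coordinates are chosen such that $Df(0)-\mu_k(0)Dg(0)=\operatorname{diag}(\lambda_1,\dots,\lambda_n)$ with $\lambda_k=0$ and $\lambda_j<0<\lambda_{j'}$ for $j<k<j'$, and such that $D\mu_k(0)e_k<0$. Let $\varepsilon_1\in(0,1]$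 and let $(v^-_\varepsilon,v^+_\varepsilon,s(\varepsilon))_{\varepsilon\in[0,\varepsilon_1]}$ be a smooth family such that * (i) for $\varepsilon>0$ it is a Lax $k$-shock: $v^\pm_\varepsilon\in\Omega$, $f(v^+_\varepsilon)-f(v^-_\varepsilon)=s(\varepsilon)(g(v^+_\varepsilon)-g(v^-_\varepsilon))$, $\mu_k(v^+_\varepsilon)<s(\varepsilon)<\mu_k(v^-_\varepsilon)$, and $(\mu_j(v^-_\varepsilon)-s(\varepsilon))(\mu_j(v^+_\varepsilon)-s(\varepsilon))>0$ for $j\ne k$; * (ii) $s(0)=\mu_k(0)$ and $s'(0)=0$; * (iii) $v^\pm_\varepsilon=\pm\varepsilon(e_k+\mathcal O(\varepsilon))$ and $(v^\pm_\varepsilon)_k=\pm\varepsilon$; * (iv) for $\varepsilon>0$, $v^-_\varepsilon$ and $v^+_\varepsilon$ are the only solutions $v\in\Omega$, $|v|<3\varepsilon$, of $f(v)-s(\varepsilon)g(v)=f(v^-_\varepsilon)-s(\varepsilon)g(v^-_\varepsilon)$. Put $\gamma_\varepsilon=(1-s(\varepsilon)^2)^{-1/2}$, $f_\varepsilon=\gamma_\varepsilon(f-s(\varepsilon)g)$,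 $g_\varepsilon=\gamma_\varepsilon(g-s(\varepsilon)f)$. A shock profile is a smooth $\phi_\varepsilon:\mathbb R\to\Omega$ with $\phi_\varepsilon'=f_\varepsilon(\phi_\varepsilon)-f_\varepsilon(v^-_\varepsilon)$ and $\phi_\varepsilon(\pm\infty)=v^\pm_\varepsilon$; we consider shock profiles of small amplitude, $|\phi_\varepsilon(x)|\le3\varepsilon$ for all $x\in\mathbb R$. For $\kappa\in\mathbb C$ let $\mathcal H^\pm_\varepsilon(\kappa)\subset\mathbb C^{2n}$ be the space of all values $\xi(0)$ of solutions $\xi:\mathbb R\to\mathbb C^{2n}$ of the Laplace-mode system $$\xi'=\begin{pmatrix}Df_\varepsilon(\phi_\varepsilon)&\mathbb 1_n\\ \kappa^2\mathbb 1_n+\kappa Dg_\varepsilon(\phi_\varepsilon)&0\end{pmatrix}\xi$$ that tend to $0$ at $\pm\infty$ (the fibres of the Evans bundles), and let $H^\pm_\varepsilon(\zeta)=\mathcal H^\pm_\varepsilon(\varepsilon^2\zeta)$ be the rescaled Evans bundles. **Lemma (outmost regime).** For any $r_1>0$ there exists $\varepsilon_0=\varepsilon_0(r_1)\in(0,\varepsilon_1]$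 such that for all $\varepsilon\in(0,\varepsilon_0]$, all such profiles $\phi_\varepsilon$, and all $\zeta\in\mathbb C$ with $\operatorname{Re}\zeta\ge0$ and $r_1\le\varepsilon^2|\zeta|$, the spaces $H^-_\varepsilon(\zeta)$ and $H^+_\varepsilon(\zeta)$ are both $n$-dimensional and are transversal: $$H^-_\varepsilon(\zeta)\cap H^+_\varepsilon(\zeta)=\{0\}.$$ -/

import Mathlib

open Set Filter Topology
open scoped ContDiff Matrix

noncomputable section

namespace HypReg

/-- The state space `ℝⁿ` with its Euclidean norm. -/
abbrev Sp (n : ℕ) := EuclideanSpace ℝ (Fin n)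

/-- The phase space `ℂ²ⁿ` of the first-order Laplace-mode system, `ξ = (p, q)`. -/
abbrev Ph (n : ℕ) := (Fin n ⊕ Fin n) → ℂ

/-- The `j`-th standard unit vector of `ℝⁿ`. -/
def unitVec {n : ℕ} (j : Fin n) : Sp n := EuclideanSpace.single j 1

/-- The Jacobian matrix of `f` at `v`. -/
def jac {n : ℕ} (f : Sp n → Sp n) (v : Sp n) : Matrix (Fin n) (Fin n) ℝ :=
  Matrix.of fun i j => (fderiv ℝ f v (unitVec j)) i

/-- `μ₁ < ⋯ < μₙ` are real eigenvalues of `F` with respect to `G`: `F r = μⱼ G r`, `r ≠ 0`.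
Since there are `n` of them, all eigenvalues are then real and simple. -/
def IsOrderedSpectrum {n : ℕ} (F G : Matrix (Fin n) (Fin n) ℝ) (μ : Fin n → ℝ) : Prop :=
  StrictMono μ ∧ ∀ j, ∃ r : Fin n → ℝ, r ≠ 0 ∧ F *ᵥ r = μ j • (G *ᵥ r)

open Classical in
/-- The eigenvalues of `F` with respect to `G` in increasing order, when they are real and simple
(for positive definite `G` they are then uniquely determined). -/
def genEig {n : ℕ} (F G : Matrix (Fin n) (Fin n) ℝ) : Fin n → ℝ :=
  if h : ∃ μ, IsOrderedSpectrum F G μ then h.choose else 0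

/-- The characteristic speed `μⱼ(v)`: the `j`-th eigenvalue of `Df(v)` with respect to `Dg(v)`. -/
def charSpeed {n : ℕ} (f g : Sp n → Sp n) (j : Fin n) (v : Sp n) : ℝ :=
  genEig (jac f v) (jac g v) j

/-- The standing assumptions A1 - A4 on `g(v)_t + f(v)_x = v_xx - v_tt` at the reference
state `0`. -/
structure StandingAssumptions {n : ℕ} (k : Fin n) (Ω : Set (Sp n)) (f g : Sp n → Sp n) :
    Prop where
  symm_f : ∀ v ∈ Ω, (jac f v).IsSymm
  symm_g : ∀ v ∈ Ω, (jac g v).IsSymm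
  posDef_g : (jac g 0).PosDef
  simple : ∃ μ, IsOrderedSpectrum (jac f 0) (jac g 0) μ
  /-- genuine nonlinearity of the `k`-th characteristic speed at `0` -/
  gnl : ∃ r : Sp n, r ≠ 0 ∧
    jac f 0 *ᵥ r.ofLp = charSpeed f g k 0 • (jac g 0 *ᵥ r.ofLp) ∧
    fderiv ℝ (charSpeed f g k) 0 r ≠ 0
  subchar_add : (jac g 0 + jac f 0).PosDef
  subchar_sub : (jac g 0 - jac f 0).PosDef

/-- The normalization of the coordinates: `f(0) = g(0) = 0`, the matrix `Df(0) - μₖ(0) Dg(0)` is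
diagonal with the stated signs (so that `eₖ` spans the `k`-th eigendirection), and `eₖ` is oriented
such that `μₖ` decreases along it. -/
structure NormalCoordinates {n : ℕ} (k : Fin n) (f g : Sp n → Sp n) : Prop where
  f_zero : f 0 = 0
  g_zero : g 0 = 0
  diag : ∃ l : Fin n → ℝ,
    jac f 0 - charSpeed f g k 0 • jac g 0 = Matrix.diagonal l ∧
    l k = 0 ∧ (∀ j, j < k → l j < 0) ∧ (∀ j, k < j → 0 < l j)
  orient : fderiv ℝ (charSpeed f g k) 0 (unitVec k) < 0

/-- `(v⁻, v⁺, s)` satisfies the Rankine-Hugoniot condition for `g(v)_t + f(v)_x = 0`. -/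
def IsShock {n : ℕ} (Ω : Set (Sp n)) (f g : Sp n → Sp n) (vm vp : Sp n) (s : ℝ) : Prop :=
  vm ∈ Ω ∧ vp ∈ Ω ∧ f vp - f vm = s • (g vp - g vm)

/-- `(v⁻, v⁺, s)` is a Lax `k`-shock. -/
def IsLaxShock {n : ℕ} (k : Fin n) (Ω : Set (Sp n)) (f g : Sp n → Sp n)
    (vm vp : Sp n) (s : ℝ) : Prop :=
  IsShock Ω f g vm vp s ∧
  charSpeed f g k vp < s ∧ s < charSpeed f g k vm ∧
  ∀ j, j ≠ k → 0 < (charSpeed f g j vm - s) * (charSpeed f g j vp - s)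

/-- The smooth families `(v⁻_ε, v⁺_ε, s(ε))`, `ε ∈ [0, ε₁]`, of small-amplitude `k`-shocks
with amplitude parameter `ε`. -/
structure IsShockFamily {n : ℕ} (k : Fin n) (Ω : Set (Sp n)) (f g : Sp n → Sp n) (ε₁ : ℝ)
    (vm vp : ℝ → Sp n) (s : ℝ → ℝ) : Prop where
  smooth_vm : ContDiffOn ℝ ∞ vm (Icc 0 ε₁)
  smooth_vp : ContDiffOn ℝ ∞ vp (Icc 0 ε₁)
  smooth_s : ContDiffOn ℝ ∞ s (Icc 0 ε₁)
  lax : ∀ ε ∈ Ioc 0 ε₁, IsLaxShock k Ω f g (vm ε) (vp ε) (s ε)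
  speed_zero : s 0 = charSpeed f g k 0
  deriv_speed_zero : derivWithin s (Icc 0 ε₁) 0 = 0
  /-- `v^±_ε = ± ε (eₖ + O(ε))` -/
  expansion : ∃ C : ℝ, ∀ ε ∈ Icc 0 ε₁,
    ‖vp ε - ε • unitVec k‖ ≤ C * ε ^ 2 ∧ ‖vm ε + ε • unitVec k‖ ≤ C * ε ^ 2
  component : ∀ ε ∈ Icc 0 ε₁, vp ε k = ε ∧ vm ε k = -ε
  /-- `v^±_ε` are the only states in the ball of radius `3ε` with the same relative flux -/
  only : ∀ ε ∈ Ioc 0 ε₁,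
    {v | v ∈ Ω ∩ Metric.ball 0 (3 * ε) ∧
      f v - s ε • g v = f (vm ε) - s ε • g (vm ε)} = {vm ε, vp ε}

/-- The Lorentz factor `γ(s) = (1 - s²)^(-1/2)`. -/
def gam (s : ℝ) : ℝ := (Real.sqrt (1 - s ^ 2))⁻¹

/-- The boosted flux `f_s = γ(s) (f - s g)`. -/
def boostF {n : ℕ} (f g : Sp n → Sp n) (s : ℝ) : Sp n → Sp n :=
  fun v => gam s • (f v - s • g v)

/-- The boosted density `g_s = γ(s) (g - s f)`. -/
def boostG {n : ℕ} (f g : Sp n → Sp n) (s : ℝ) : Sp n → Sp n :=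
  fun v => gam s • (g v - s • f v)

/-- `φ` is a shock profile for `(v⁻, v⁺, s)`:
`φ' = f_s(φ) - f_s(v⁻)`, `φ(±∞) = v^±`. -/
structure IsShockProfile {n : ℕ} (Ω : Set (Sp n)) (f g : Sp n → Sp n) (vm vp : Sp n) (s : ℝ)
    (φ : ℝ → Sp n) : Prop where
  smooth : ContDiff ℝ ∞ φ
  mem : ∀ x, φ x ∈ Ω
  ode : ∀ x, HasDerivAt φ (boostF f g s (φ x) - boostF f g s vm) x
  left : Tendsto φ atBot (𝓝 vm)
  right : Tendsto φ atTop (𝓝 vp)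

/-- The coefficient matrix
`[[Df_s(v), 1], [κ² 1 + κ Dg_s(v), 0]]` of the Laplace-mode system. -/
def modeMatrix {n : ℕ} (f g : Sp n → Sp n) (s : ℝ) (κ : ℂ) (v : Sp n) :
    Matrix (Fin n ⊕ Fin n) (Fin n ⊕ Fin n) ℂ :=
  Matrix.fromBlocks ((jac (boostF f g s) v).map Complex.ofReal) 1
    (κ ^ 2 • (1 : Matrix (Fin n) (Fin n) ℂ) + κ • (jac (boostG f g s) v).map Complex.ofReal) 0

/-- `ξ` solves the Laplace-mode system along `φ` on the whole line. -/
def IsModeSolution {n : ℕ} (f g : Sp n → Sp n) (s : ℝ) (κ : ℂ) (φ : ℝ → Sp n)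
    (ξ : ℝ → Ph n) : Prop :=
  ∀ x, HasDerivAt ξ (modeMatrix f g s κ (φ x) *ᵥ ξ x) x

/-- The initial values at `x = 0` of the solutions of the Laplace-mode system that tend to zero
along the filter `l`. -/
def decaySpace {n : ℕ} (f g : Sp n → Sp n) (s : ℝ) (κ : ℂ) (φ : ℝ → Sp n) (l : Filter ℝ) :
    Submodule ℂ (Ph n) where
  carrier := {ξ₀ | ∃ ξ, IsModeSolution f g s κ φ ξ ∧ ξ 0 = ξ₀ ∧ Tendsto ξ l (𝓝 0)}
  zero_mem' := by
    refine ⟨fun _ => 0, fun x => ?_, rfl, tendsto_const_nhds⟩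
    simpa using hasDerivAt_const x (0 : Ph n)
  add_mem' := by
    rintro a b ⟨ξ, h1, rfl, h3⟩ ⟨η, k1, rfl, k3⟩
    refine ⟨fun x => ξ x + η x, fun x => ?_, rfl, by simpa using h3.add k3⟩
    rw [Matrix.mulVec_add]
    exact (h1 x).add (k1 x)
  smul_mem' := by
    rintro c a ⟨ξ, h1, rfl, h3⟩
    refine ⟨fun x => c • ξ x, fun x => ?_, rfl, by simpa using h3.const_smul c⟩
    rw [Matrix.mulVec_smul]
    exact (h1 x).const_smul c

/-- The fibre `𝓗⁺(κ)` of the Evans bundle: initial values of the solutions decaying at `+∞`. -/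
def evansPlus {n : ℕ} (f g : Sp n → Sp n) (s : ℝ) (φ : ℝ → Sp n) (κ : ℂ) :
    Submodule ℂ (Ph n) := decaySpace f g s κ φ atTop

/-- The fibre `𝓗⁻(κ)` of the Evans bundle: initial values of the solutions decaying at `-∞`. -/
def evansMinus {n : ℕ} (f g : Sp n → Sp n) (s : ℝ) (φ : ℝ → Sp n) (κ : ℂ) :
    Submodule ℂ (Ph n) := decaySpace f g s κ φ atBot

/-- The rescaled Evans bundle `H⁺_ε(ζ) = 𝓗⁺_ε(ε² ζ)`. -/
def rescaledEvansPlus {n : ℕ} (f g : Sp n → Sp n) (s : ℝ) (φ : ℝ → Sp n) (ε : ℝ) (ζ : ℂ) :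
    Submodule ℂ (Ph n) := evansPlus f g s φ ((ε : ℂ) ^ 2 * ζ)

/-- The rescaled Evans bundle `H⁻_ε(ζ) = 𝓗⁻_ε(ε² ζ)`. -/
def rescaledEvansMinus {n : ℕ} (f g : Sp n → Sp n) (s : ℝ) (φ : ℝ → Sp n) (ε : ℝ) (ζ : ℂ) :
    Submodule ℂ (Ph n) := evansMinus f g s φ ((ε : ℂ) ^ 2 * ζ)

end HypReg

end

/-! With κ = ε²ζ and q = κw the mode system becomes p' = Ap + κw, w' = (κ + B)p, where A, B are
Df_ε, Dg_ε along the profile. For u = p + w, z = p - w this reads u' = (A + B)p + κu, z' = -(B - A)p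
- κz. At the reference state A₀ + B₀ and B₀ - A₀ are positive multiples of Dg(0) + Df(0) and Dg(0) -
Df(0), hence positive definite by (A4). Let R, T be twice their inverses. For Re κ ≥ 0, half the
derivative of ⟨u, Ru⟩ - ⟨z, Tz⟩ is at least 2 Re⟨u + z, p⟩ = 4|p|². A small cross term 2 Re⟨p, σw⟩
with σ parallel to κ adds control of |w|² (`exists_uniform_lyapunov`). As |κ| is bounded below, the
estimate is uniform in κ and survives small perturbations of A and B; small ε causes only such
perturbations.

The resulting form is positive on {w = p} and negative on {w = -p}, both of dimension n, and
strictly increases along nonzero solutions. A nonzero solution decaying at +∞ therefore has negative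
energy, one decaying at -∞ positive energy, which gives transversality. The signature bounds both
dimensions from above, and a compactness argument supplies enough decaying solutions
(`decaying_dichotomy`). Only continuity and boundedness of the coefficients matter, not their limits
at ±∞. -/

namespace HypReg

/-! ### Global solvability of linear equations with bounded coefficients -/

section LinearODE

variable {E : Type*} [NormedAddCommGroup E] [NormedSpace ℝ E]

/-- Integrating the weight cosh(2Kt) gains a factor 1/(2K), and |sinh| ≤ cosh returns to the weight.
This is the contraction factor 1/2 of the Picard map. -/
theorem norm_integral_cosh_smul_le {K : ℝ} (hK : 0 < K) {h : ℝ → E} {C : ℝ}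
    (hC : ∀ t, ‖h t‖ ≤ K * C) (x : ℝ) :
    ‖∫ t in (0 : ℝ)..x, Real.cosh (2 * K * t) • h t‖ ≤ Real.cosh (2 * K * x) * (C / 2) := by
  have hC0 : 0 ≤ C := by
    have := (norm_nonneg _).trans (hC 0)
    exact nonneg_of_mul_nonneg_right this hK
  have h_primitive : ∫ t in (0 : ℝ)..x, Real.cosh (2 * K * t) * (K * C)
      = Real.sinh (2 * K * x) * (C / 2) := by
    have hd : ∀ t ∈ uIcc 0 x, HasDerivAt (fun t => Real.sinh (2 * K * t) * (C / 2))
        (Real.cosh (2 * K * t) * (K * C)) t := by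
      intro t _
      have h1 : HasDerivAt (fun t : ℝ => 2 * K * t) (2 * K) t := by
        simpa using (hasDerivAt_id t).const_mul (2 * K)
      have h2 := h1.sinh.mul_const (C / 2)
      rwa [show Real.cosh (2 * K * t) * (2 * K) * (C / 2) = Real.cosh (2 * K * t) * (K * C) by
        ring] at h2
    rw [intervalIntegral.integral_eq_sub_of_hasDerivAt hd
      (Continuous.intervalIntegrable (by fun_prop) _ _)]
    simp
  calc ‖∫ t in (0 : ℝ)..x, Real.cosh (2 * K * t) • h t‖
      ≤ |∫ t in (0 : ℝ)..x, Real.cosh (2 * K * t) * (K * C)| := by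
        refine intervalIntegral.norm_integral_le_abs_of_norm_le
          (Eventually.of_forall fun t => ?_)
          (Continuous.intervalIntegrable (by fun_prop) _ _)
        rw [norm_smul, Real.norm_of_nonneg (Real.cosh_pos _).le]
        exact mul_le_mul_of_nonneg_left (hC t) (Real.cosh_pos _).le
    _ = |Real.sinh (2 * K * x)| * (C / 2) := by
        rw [h_primitive, abs_mul, abs_of_nonneg (by positivity : 0 ≤ C / 2)]
    _ ≤ _ := by
        refine mul_le_mul_of_nonneg_right ?_ (by positivity)
        rw [Real.abs_sinh, ← Real.cosh_abs]
        exact (Real.sinh_lt_cosh _).le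

/-- A linear equation with continuous bounded coefficients has global solutions. The proof is a
contraction argument in a space of functions weighted by a hyperbolic cosine. -/
theorem exists_global_solution_zero [CompleteSpace E] {M : ℝ → E →L[ℝ] E} (hM : Continuous M)
    {K : ℝ} (hK : ∀ x, ‖M x‖ ≤ K) (a : E) :
    ∃ ξ : ℝ → E, (∀ x, HasDerivAt ξ (M x (ξ x)) x) ∧ ξ 0 = a := by
  -- The rate 2K of the weight must be nonzero; a vanishing bound is enlarged to K + 1.
  wlog hK0 : 0 < K generalizing K
  · exact this (K := K + 1) (fun x => (hK x).trans (by linarith))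
      (by linarith [(norm_nonneg _).trans (hK 0)])
  have hc : ∀ x, 0 < Real.cosh (2 * K * x) := fun x => Real.cosh_pos _
  have hMη : ∀ (η : BoundedContinuousFunction ℝ E) (t : ℝ), ‖M t (η t)‖ ≤ K * ‖η‖ := fun η t =>
    ((M t).le_opNorm _).trans
      (mul_le_mul (hK t) (η.norm_coe_le_norm t) (norm_nonneg _) hK0.le)
  have hcont : ∀ η : BoundedContinuousFunction ℝ E,
      Continuous fun t => Real.cosh (2 * K * t) • M t (η t) := fun η =>
    (by fun_prop : Continuous fun t : ℝ => Real.cosh (2 * K * t)).smul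
      (hM.clm_apply η.continuous)
  -- The unknown is η = ξ / cosh(2Kx), which is bounded even though ξ may grow exponentially; `F` is
  -- the Picard map in this variable.
  let F : BoundedContinuousFunction ℝ E → ℝ → E := fun η x =>
    (Real.cosh (2 * K * x))⁻¹ • (a + ∫ t in (0 : ℝ)..x, Real.cosh (2 * K * t) • M t (η t))
  have hFc : ∀ η, Continuous (F η) := fun η => by
    refine Continuous.smul ?_ (continuous_const.add ?_)
    · exact (by fun_prop : Continuous fun t : ℝ => Real.cosh (2 * K * t)).inv₀
        fun x => (hc x).ne'
    · exact intervalIntegral.continuous_primitive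
        (fun _ _ => (hcont η).intervalIntegrable _ _) 0
  have hFb : ∀ η x, ‖F η x‖ ≤ ‖a‖ + ‖η‖ / 2 := fun η x => by
    have h1 := norm_integral_cosh_smul_le hK0 (hMη η) x
    have h2 : 1 ≤ Real.cosh (2 * K * x) := Real.one_le_cosh _
    rw [norm_smul, norm_inv, Real.norm_of_nonneg (hc x).le, inv_mul_le_iff₀ (hc x)]
    refine (norm_add_le _ _).trans ?_
    nlinarith [norm_nonneg a]
  let T : BoundedContinuousFunction ℝ E → BoundedContinuousFunction ℝ E := fun η =>
    BoundedContinuousFunction.ofNormedAddCommGroup (F η) (hFc η) _ (hFb η)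
  have hT : ContractingWith (1 / 2) T := by
    refine ⟨by norm_num, LipschitzWith.of_dist_le_mul fun η θ => ?_⟩
    have hnn : 0 ≤ ((1 / 2 : NNReal) : ℝ) * dist η θ := by positivity
    refine (BoundedContinuousFunction.dist_le hnn).2 fun x => ?_
    have h1 : F η x - F θ x = (Real.cosh (2 * K * x))⁻¹ •
        ∫ t in (0 : ℝ)..x, Real.cosh (2 * K * t) • M t ((η - θ) t) := by
      simp only [F, ← smul_sub, add_sub_add_left_eq_sub]
      rw [← intervalIntegral.integral_sub ((hcont η).intervalIntegrable _ _)
        ((hcont θ).intervalIntegrable _ _)]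
      simp [smul_sub]
    change dist (F η x) (F θ x) ≤ _
    rw [dist_eq_norm, h1, norm_smul, norm_inv, Real.norm_of_nonneg (hc x).le,
      inv_mul_le_iff₀ (hc x), dist_eq_norm]
    refine (norm_integral_cosh_smul_le hK0 (hMη (η - θ)) x).trans (le_of_eq ?_)
    push_cast
    ring
  obtain ⟨η, hη⟩ : ∃ η, T η = η := ⟨_, hT.fixedPoint_isFixedPt⟩
  refine ⟨fun x => a + ∫ t in (0 : ℝ)..x, Real.cosh (2 * K * t) • M t (η t), fun x => ?_, by simp⟩
  have hfix : η x = F η x := by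
    conv_lhs => rw [← hη]
    rfl
  have h := ((hcont η).integral_hasStrictDerivAt 0 x).hasDerivAt.const_add a
  convert h using 1
  rw [hfix, ← map_smul]
  simp only [F]
  rw [smul_inv_smul₀ (hc x).ne']

theorem exists_global_solution [CompleteSpace E] {M : ℝ → E →L[ℝ] E} (hM : Continuous M)
    {K : ℝ} (hK : ∀ x, ‖M x‖ ≤ K) (x₀ : ℝ) (a : E) :
    ∃ ξ : ℝ → E, (∀ x, HasDerivAt ξ (M x (ξ x)) x) ∧ ξ x₀ = a := by
  obtain ⟨ξ, h1, h2⟩ := exists_global_solution_zero (M := fun x => M (x + x₀))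
    (hM.comp (continuous_add_const x₀)) (fun x => hK _) a
  refine ⟨fun x => ξ (x - x₀), fun x => ?_, by simpa using h2⟩
  simpa using (h1 (x - x₀)).comp_sub_const x x₀

theorem global_solution_unique {M : ℝ → E →L[ℝ] E} {K : ℝ} (hK : ∀ x, ‖M x‖ ≤ K) {ξ η : ℝ → E}
    (hξ : ∀ x, HasDerivAt ξ (M x (ξ x)) x) (hη : ∀ x, HasDerivAt η (M x (η x)) x)
    {x₀ : ℝ} (h : ξ x₀ = η x₀) : ξ = η := by
  refine ODE_solution_unique_univ (v := fun x y => M x y) (s := fun _ => univ)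
    (K := ⟨K, (norm_nonneg _).trans (hK 0)⟩) (fun x => ?_) (fun x => ⟨hξ x, trivial⟩)
    (fun x => ⟨hη x, trivial⟩) h
  exact ((M x).lipschitz.weaken (hK x)).lipschitzOnWith

end LinearODE

/-! ### Exponential dichotomy from a strict Lyapunov form -/

section Dichotomy

variable {W : Type*} [NormedAddCommGroup W] [InnerProductSpace ℂ W]

/-- The space of global solutions of `ξ' = M(x) ξ`. -/
def solutionSpace (M : ℝ → W →L[ℂ] W) : Submodule ℂ (ℝ → W) where
  carrier := {ξ | ∀ x, HasDerivAt ξ (M x (ξ x)) x}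
  zero_mem' := fun x => by simp
  add_mem' := fun h k x => by simpa using (h x).add (k x)
  smul_mem' := fun c ξ h x => by simpa using (h x).const_smul c

theorem eval_solutionSpace_bijective [CompleteSpace W] {M : ℝ → W →L[ℂ] W} (hM : Continuous M)
    {K : ℝ} (hK : ∀ x, ‖M x‖ ≤ K) (x : ℝ) :
    Function.Bijective ((LinearMap.proj x : (ℝ → W) →ₗ[ℂ] W) ∘ₗ (solutionSpace M).subtype) := by
  have hK' : ∀ x, ‖(M x).restrictScalars ℝ‖ ≤ K := fun x => by
    rw [ContinuousLinearMap.norm_restrictScalars]; exact hK x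
  constructor
  · rintro ⟨ξ, hξ⟩ ⟨η, hη⟩ h
    exact Subtype.ext (global_solution_unique (M := fun x => (M x).restrictScalars ℝ) hK' hξ hη h)
  · intro a
    obtain ⟨ξ, h1, h2⟩ := exists_global_solution (M := fun x => (M x).restrictScalars ℝ)
      ((ContinuousLinearMap.restrictScalarsL ℂ W W ℝ ℝ).continuous.comp hM) hK' x a
    exact ⟨⟨ξ, h1⟩, h2⟩

/-- The solution operator from time `0` to time `x`. -/
noncomputable def flow [CompleteSpace W] {M : ℝ → W →L[ℂ] W} (hM : Continuous M)
    {K : ℝ} (hK : ∀ x, ‖M x‖ ≤ K) (x : ℝ) : W ≃ₗ[ℂ] W :=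
  (LinearEquiv.ofBijective _ (eval_solutionSpace_bijective hM hK 0)).symm.trans
    (LinearEquiv.ofBijective _ (eval_solutionSpace_bijective hM hK x))

theorem flow_zero [CompleteSpace W] {M : ℝ → W →L[ℂ] W} (hM : Continuous M)
    {K : ℝ} (hK : ∀ x, ‖M x‖ ≤ K) (a : W) : flow hM hK 0 a = a := by
  simp [flow]

theorem hasDerivAt_flow [CompleteSpace W] {M : ℝ → W →L[ℂ] W} (hM : Continuous M)
    {K : ℝ} (hK : ∀ x, ‖M x‖ ≤ K) (a : W) (x : ℝ) :
    HasDerivAt (fun x => flow hM hK x a) (M x (flow hM hK x a)) x :=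
  ((LinearEquiv.ofBijective _ (eval_solutionSpace_bijective hM hK 0)).symm a).2 x

/-- The quadratic form `⟨ξ, S ξ⟩` of a symmetric operator `S`. -/
noncomputable def energy (S : W →L[ℂ] W) (ξ : W) : ℝ := (inner ℂ ξ (S ξ)).re

theorem continuous_energy (S : W →L[ℂ] W) : Continuous (energy S) :=
  Complex.continuous_re.comp (continuous_id.inner S.continuous)

theorem hasDerivAt_energy {S : W →L[ℂ] W} (hS : S.IsSymmetric) {ξ : ℝ → W} {ξ' : W} {x : ℝ}
    (hξ : HasDerivAt ξ ξ' x) :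
    HasDerivAt (fun x => energy S (ξ x)) (2 * (inner ℂ (S (ξ x)) ξ').re) x := by
  have h1 : HasDerivAt (fun x => S (ξ x)) (S ξ') x :=
    (S.restrictScalars ℝ).hasFDerivAt.comp_hasDerivAt x hξ
  have h2 := Complex.reCLM.hasFDerivAt.comp_hasDerivAt x (hξ.inner ℂ h1)
  refine h2.congr_deriv ?_
  have h3 : inner ℂ (S (ξ x)) ξ' = inner ℂ (ξ x) (S ξ') := hS (ξ x) ξ'
  have h4 : (inner ℂ ξ' (S (ξ x))).re = (inner ℂ (S (ξ x)) ξ').re := by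
    rw [← inner_conj_symm, Complex.conj_re]
  simp only [Complex.reCLM_apply, Complex.add_re, h4, ← h3]
  ring

theorem hasDerivAt_norm_sq {ξ : ℝ → W} {ξ' : W} {x : ℝ} (hξ : HasDerivAt ξ ξ' x) :
    HasDerivAt (fun x => ‖ξ x‖ ^ 2) (2 * (inner ℂ (ξ x) ξ').re) x := by
  have h := hasDerivAt_energy (S := ContinuousLinearMap.id ℂ W) (fun _ _ => rfl) hξ
  refine (h.congr_of_eventuallyEq (Eventually.of_forall fun y => ?_))
  exact (inner_self_eq_norm_sq (𝕜 := ℂ) (ξ y)).symm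

theorem abs_energy_le (S : W →L[ℂ] W) (ξ : W) : |energy S ξ| ≤ ‖S‖ * ‖ξ‖ ^ 2 := by
  calc |energy S ξ| ≤ ‖inner ℂ ξ (S ξ)‖ := Complex.abs_re_le_norm _
    _ ≤ ‖ξ‖ * (‖S‖ * ‖ξ‖) :=
      (norm_inner_le_norm _ _).trans (mul_le_mul_of_nonneg_left (S.le_opNorm _) (norm_nonneg _))
    _ = _ := by ring

theorem monotone_energy {M : ℝ → W →L[ℂ] W} {S : W →L[ℂ] W} (hS : S.IsSymmetric)
    {δ : ℝ} (hδ : 0 < δ) (hE : ∀ x ξ, δ * ‖ξ‖ ^ 2 ≤ (inner ℂ (S ξ) (M x ξ)).re)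
    {ξ : ℝ → W} (hξ : ∀ x, HasDerivAt ξ (M x (ξ x)) x) : Monotone fun x => energy S (ξ x) :=
  monotone_of_hasDerivAt_nonneg (fun x => hasDerivAt_energy hS (hξ x)) fun x => by
    have := hE x (ξ x)
    have h2 : 0 ≤ δ * ‖ξ x‖ ^ 2 := by positivity
    simp only [Pi.zero_apply]
    linarith

theorem energy_nonpos_of_tendsto {M : ℝ → W →L[ℂ] W} {S : W →L[ℂ] W} (hS : S.IsSymmetric)
    {δ : ℝ} (hδ : 0 < δ) (hE : ∀ x ξ, δ * ‖ξ‖ ^ 2 ≤ (inner ℂ (S ξ) (M x ξ)).re)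
    {ξ : ℝ → W} (hξ : ∀ x, HasDerivAt ξ (M x (ξ x)) x) (h0 : Tendsto ξ atTop (𝓝 0)) (x : ℝ) :
    energy S (ξ x) ≤ 0 := by
  have h1 : Tendsto (fun x => energy S (ξ x)) atTop (𝓝 0) := by
    have := ((continuous_energy S).tendsto 0).comp h0
    simpa [energy, Function.comp_def] using this
  exact (monotone_energy hS hδ hE hξ).ge_of_tendsto h1 x

/-- The energy increases to its limit 0. If it vanished at time 0 it would vanish on all of [0, ∞),
so its right derivative at 0 would be 0, against the strict growth at ξ(0) ≠ 0. -/
theorem energy_neg_of_tendsto {M : ℝ → W →L[ℂ] W} {S : W →L[ℂ] W} (hS : S.IsSymmetric)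
    {δ : ℝ} (hδ : 0 < δ) (hE : ∀ x ξ, δ * ‖ξ‖ ^ 2 ≤ (inner ℂ (S ξ) (M x ξ)).re)
    {ξ : ℝ → W} (hξ : ∀ x, HasDerivAt ξ (M x (ξ x)) x) (h0 : Tendsto ξ atTop (𝓝 0))
    (hne : ξ 0 ≠ 0) : energy S (ξ 0) < 0 := by
  have hle := energy_nonpos_of_tendsto hS hδ hE hξ h0
  refine (hle 0).lt_of_ne fun h => ?_
  have hmono := monotone_energy hS hδ hE hξ
  have hconst : ∀ x ∈ Ici (0 : ℝ), energy S (ξ x) = 0 := fun x hx =>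
    le_antisymm (hle x) (h ▸ hmono hx)
  have h1 := (hasDerivAt_energy hS (hξ 0)).hasDerivWithinAt (s := Ici 0)
  have h2 := (hasDerivWithinAt_const (0 : ℝ) (Ici 0) (0 : ℝ)).congr hconst
    (hconst 0 self_mem_Ici)
  have h3 := (uniqueDiffWithinAt_Ici (0 : ℝ)).eq_deriv _ h1 h2
  have h4 := hE 0 (ξ 0)
  have h5 : 0 < δ * ‖ξ 0‖ ^ 2 := by positivity
  linarith

/-- Nonpositive energy for all x ≥ 0 leaves a solution no room to grow: subtracting a large multiple
of the energy from ‖ξ‖² gives a quantity that dominates ‖ξ‖² and decays exponentially. -/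
theorem tendsto_zero_of_energy_nonpos {M : ℝ → W →L[ℂ] W} {K : ℝ} (hK : ∀ x, ‖M x‖ ≤ K)
    {S : W →L[ℂ] W} (hS : S.IsSymmetric)
    {δ : ℝ} (hδ : 0 < δ) (hE : ∀ x ξ, δ * ‖ξ‖ ^ 2 ≤ (inner ℂ (S ξ) (M x ξ)).re)
    {ξ : ℝ → W} (hξ : ∀ x, HasDerivAt ξ (M x (ξ x)) x)
    (hneg : ∀ x, 0 ≤ x → energy S (ξ x) ≤ 0) : Tendsto ξ atTop (𝓝 0) := by
  have hK0 : 0 ≤ K := (norm_nonneg _).trans (hK 0)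
  -- With this q the derivative of ‖ξ‖² - q·energy is at most 2K‖ξ‖² - 2(K + 1)‖ξ‖² = -2‖ξ‖². The
  -- quantity itself is at most ‖ξ‖²/c, which yields the decay rate c.
  set q : ℝ := (K + 1) / δ with hq
  have hq0 : 0 < q := by positivity
  set c : ℝ := 1 / (1 + q * ‖S‖) with hc
  have hc0 : 0 < c := by positivity
  have hcm : c * (1 + q * ‖S‖) = 1 := by rw [hc]; field_simp
  -- `‖ξ‖² - q ⟨ξ, S ξ⟩` is an exponentially decaying majorant of `‖ξ‖²`.
  have hd : ∀ x, HasDerivAt (fun x => Real.exp (c * x) * (‖ξ x‖ ^ 2 - q * energy S (ξ x)))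
      (Real.exp (c * x) * c * (‖ξ x‖ ^ 2 - q * energy S (ξ x)) + Real.exp (c * x) *
        (2 * (inner ℂ (ξ x) (M x (ξ x))).re - q * (2 * (inner ℂ (S (ξ x)) (M x (ξ x))).re))) x := by
    intro x
    have h1 : HasDerivAt (fun x : ℝ => c * x) c x := by
      simpa using (hasDerivAt_id x).const_mul c
    exact h1.exp.mul ((hasDerivAt_norm_sq (hξ x)).sub
      ((hasDerivAt_energy hS (hξ x)).const_mul q))
  have hanti : Antitone fun x => Real.exp (c * x) * (‖ξ x‖ ^ 2 - q * energy S (ξ x)) := by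
    refine antitone_of_hasDerivAt_nonpos hd fun x => ?_
    have h1 : (inner ℂ (ξ x) (M x (ξ x))).re ≤ K * ‖ξ x‖ ^ 2 := by
      calc (inner ℂ (ξ x) (M x (ξ x))).re ≤ ‖inner ℂ (ξ x) (M x (ξ x))‖ := Complex.re_le_norm _
        _ ≤ ‖ξ x‖ * (K * ‖ξ x‖) := (norm_inner_le_norm _ _).trans
          (mul_le_mul_of_nonneg_left ((M x).le_of_opNorm_le (hK x) _) (norm_nonneg _))
        _ = _ := by ring
    have h2 : (K + 1) * ‖ξ x‖ ^ 2 ≤ q * (inner ℂ (S (ξ x)) (M x (ξ x))).re := by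
      calc (K + 1) * ‖ξ x‖ ^ 2 = q * (δ * ‖ξ x‖ ^ 2) := by rw [hq]; field_simp
        _ ≤ _ := mul_le_mul_of_nonneg_left (hE x (ξ x)) hq0.le
    have h3 : c * (‖ξ x‖ ^ 2 - q * energy S (ξ x)) ≤ ‖ξ x‖ ^ 2 := by
      have h4 : -energy S (ξ x) ≤ ‖S‖ * ‖ξ x‖ ^ 2 := (neg_le_abs _).trans (abs_energy_le S _)
      calc c * (‖ξ x‖ ^ 2 - q * energy S (ξ x))
          = c * (‖ξ x‖ ^ 2 + q * -energy S (ξ x)) := by ring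
        _ ≤ c * (‖ξ x‖ ^ 2 + q * (‖S‖ * ‖ξ x‖ ^ 2)) := by gcongr
        _ = (c * (1 + q * ‖S‖)) * ‖ξ x‖ ^ 2 := by ring
        _ = _ := by rw [hcm, one_mul]
    have h5 := Real.exp_pos (c * x)
    have h6 : 0 ≤ ‖ξ x‖ ^ 2 := by positivity
    rw [Pi.zero_apply, mul_assoc, ← mul_add]
    refine mul_nonpos_of_nonneg_of_nonpos h5.le ?_
    linarith
  set F0 : ℝ := ‖ξ 0‖ ^ 2 - q * energy S (ξ 0) with hF0
  have hbound : ∀ x, 0 ≤ x → ‖ξ x‖ ^ 2 ≤ F0 * Real.exp (-(c * x)) := by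
    intro x hx
    have h1 : Real.exp (c * x) * (‖ξ x‖ ^ 2 - q * energy S (ξ x)) ≤ F0 := by
      simpa [hF0] using hanti hx
    have h2 : 0 ≤ q * -energy S (ξ x) := mul_nonneg hq0.le (by linarith [hneg x hx])
    rw [Real.exp_neg, ← div_eq_mul_inv, le_div_iff₀ (Real.exp_pos _), mul_comm]
    refine le_trans (mul_le_mul_of_nonneg_left ?_ (Real.exp_pos _).le) h1
    linarith
  have hexp : Tendsto (fun x : ℝ => F0 * Real.exp (-(c * x))) atTop (𝓝 0) := by
    have h1 : Tendsto (fun x : ℝ => c * x) atTop atTop := tendsto_id.const_mul_atTop hc0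
    simpa using (Real.tendsto_exp_neg_atTop_nhds_zero.comp h1).const_mul F0
  have hsq : Tendsto (fun x => ‖ξ x‖ ^ 2) atTop (𝓝 0) :=
    squeeze_zero' (Eventually.of_forall fun x => by positivity)
      ((eventually_ge_atTop 0).mono hbound) hexp
  have := hsq.sqrt
  simp only [Real.sqrt_sq (norm_nonneg _), Real.sqrt_zero] at this
  exact tendsto_zero_iff_norm_tendsto_zero.2 this

/-- If every member of a nested sequence of closed sets contains an `m`-dimensional subspace, so
does the intersection. -/
theorem exists_submodule_forall_subset [FiniteDimensional ℂ W] {m : ℕ} {C : ℕ → Set W}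
    (hC : ∀ i, IsClosed (C i)) (hanti : ∀ i, C (i + 1) ⊆ C i)
    (hne : ∀ i, ∃ N : Submodule ℂ W, Module.finrank ℂ N = m ∧ (N : Set W) ⊆ C i) :
    ∃ N : Submodule ℂ W, Module.finrank ℂ N = m ∧ ∀ i, (N : Set W) ⊆ C i := by
  have : ProperSpace W := FiniteDimensional.proper ℂ W
  -- Subspaces are represented by orthonormal m-frames, which form a compact set; frames with span
  -- in `C i` form a closed subset, so Cantor's intersection theorem applies.
  let F : ℕ → Set (Fin m → W) := fun i =>
    {u | Orthonormal ℂ u ∧ ∀ c : Fin m → ℂ, ∑ j, c j • u j ∈ C i}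
  have hclosed : ∀ i, IsClosed (F i) := fun i => by
    have h1 : F i = (⋂ j, ⋂ l, {u : Fin m → W | inner ℂ (u j) (u l) = if j = l then 1 else 0}) ∩
        ⋂ c : Fin m → ℂ, {u | ∑ j, c j • u j ∈ C i} := by
      ext u
      simp [F, orthonormal_iff_ite]
    rw [h1]
    refine IsClosed.inter (isClosed_iInter fun j => isClosed_iInter fun l => ?_)
      (isClosed_iInter fun c => (hC i).preimage (by fun_prop))
    exact isClosed_eq ((continuous_apply j).inner (continuous_apply l)) continuous_const
  have hcomp : IsCompact (F 0) := by
    refine (isCompact_univ_pi fun _ : Fin m => isCompact_closedBall (0 : W) 1).of_isClosed_subset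
      (hclosed 0) fun u hu j _ => ?_
    simp [hu.1.1 j]
  obtain ⟨u, hu⟩ := IsCompact.nonempty_iInter_of_sequence_nonempty_isCompact_isClosed F
    (fun i u hu => ⟨hu.1, fun c => hanti i (hu.2 c)⟩)
    (fun i => by
      obtain ⟨N, hN, hNC⟩ := hne i
      let b := (stdOrthonormalBasis ℂ N).reindex (finCongr hN)
      refine ⟨fun j => (b j : W), ?_, fun c => hNC ?_⟩
      · exact b.orthonormal.comp_linearIsometry N.subtypeₗᵢ
      · exact N.sum_mem fun j _ => N.smul_mem _ (b j).2)
    hcomp hclosed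
  rw [mem_iInter] at hu
  refine ⟨Submodule.span ℂ (range u), ?_, fun i x hx => ?_⟩
  · simpa using finrank_span_eq_card (hu 0).1.linearIndependent
  · obtain ⟨c, rfl⟩ := (Submodule.mem_span_range_iff_exists_fun ℂ).1 hx
    exact (hu i).2 c

/-- Under a strict Lyapunov condition, the space of initial values of solutions that decay at
`+∞` has the dimension of a maximal negative subspace of the Lyapunov form. -/
theorem finrank_decaying [FiniteDimensional ℂ W] {M : ℝ → W →L[ℂ] W} (hM : Continuous M)
    {K : ℝ} (hK : ∀ x, ‖M x‖ ≤ K) {S : W →L[ℂ] W} (hS : S.IsSymmetric)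
    {δ : ℝ} (hδ : 0 < δ) (hE : ∀ x ξ, δ * ‖ξ‖ ^ 2 ≤ (inner ℂ (S ξ) (M x ξ)).re)
    {N P : Submodule ℂ W} (hN : ∀ ξ ∈ N, energy S ξ ≤ 0) (hP : ∀ ξ ∈ P, ξ ≠ 0 → 0 < energy S ξ)
    (hNP : Module.finrank ℂ N + Module.finrank ℂ P = Module.finrank ℂ W)
    {H : Submodule ℂ W} (hH : ∀ a, a ∈ H ↔
      ∃ ξ : ℝ → W, (∀ x, HasDerivAt ξ (M x (ξ x)) x) ∧ ξ 0 = a ∧ Tendsto ξ atTop (𝓝 0)) :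
    Module.finrank ℂ H = Module.finrank ℂ N := by
  have : CompleteSpace W := FiniteDimensional.complete ℂ W
  refine le_antisymm ?_ ?_
  -- Upper bound: decaying solutions have nonpositive energy, so `H` meets the positive space `P`
  -- only in 0.
  · have hdisj : H ⊓ P = ⊥ := by
      rw [eq_bot_iff]
      rintro a ⟨haH, haP⟩
      obtain ⟨ξ, h1, rfl, h3⟩ := (hH a).1 haH
      by_contra hne
      exact absurd (hP _ haP hne) (energy_nonpos_of_tendsto hS hδ hE h1 h3 0).not_gt
    have h1 := Submodule.finrank_sup_add_finrank_inf_eq H P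
    have h2 := Submodule.finrank_le (H ⊔ P)
    rw [hdisj, finrank_bot] at h1
    omega
  -- Lower bound: initial values with nonpositive energy at time i form closed sets, nested because
  -- energy increases. Each contains the pullback of `N` under the flow; a subspace common to all of
  -- them consists of decaying solutions.
  · obtain ⟨N', hN', hsub⟩ := exists_submodule_forall_subset (W := W) (m := Module.finrank ℂ N)
      (C := fun i : ℕ => {a | energy S (flow hM hK i a) ≤ 0})
      (fun i => isClosed_le ((continuous_energy S).comp
        (flow hM hK i).toLinearMap.continuous_of_finiteDimensional) continuous_const)
      (fun i a ha => (monotone_energy hS hδ hE (hasDerivAt_flow hM hK a)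
        (by simp : (i : ℝ) ≤ ((i + 1 : ℕ) : ℝ))).trans ha)
      (fun i => ⟨N.map (flow hM hK i).symm.toLinearMap, LinearEquiv.finrank_map_eq _ _, by
        rintro _ ⟨b, hb, rfl⟩
        simpa using hN b hb⟩)
    rw [← hN']
    refine Submodule.finrank_mono fun a ha => (hH a).2
      ⟨fun x => flow hM hK x a, hasDerivAt_flow hM hK a, flow_zero hM hK a, ?_⟩
    -- Integer times suffice, since the energy at x is at most that at ⌈x⌉.
    refine tendsto_zero_of_energy_nonpos hK hS hδ hE (hasDerivAt_flow hM hK a) fun x _ => ?_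
    exact (monotone_energy hS hδ hE (hasDerivAt_flow hM hK a) (Nat.le_ceil x)).trans
      (hsub ⌈x⌉₊ ha)

/-- The two-sided version: dimensions and transversality of the spaces of initial values of
solutions decaying at `-∞` and at `+∞`. -/
theorem decaying_dichotomy [FiniteDimensional ℂ W] {M : ℝ → W →L[ℂ] W} (hM : Continuous M)
    {K : ℝ} (hK : ∀ x, ‖M x‖ ≤ K) {S : W →L[ℂ] W} (hS : S.IsSymmetric)
    {δ : ℝ} (hδ : 0 < δ) (hE : ∀ x ξ, δ * ‖ξ‖ ^ 2 ≤ (inner ℂ (S ξ) (M x ξ)).re)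
    {N P : Submodule ℂ W} (hN : ∀ ξ ∈ N, ξ ≠ 0 → energy S ξ < 0)
    (hP : ∀ ξ ∈ P, ξ ≠ 0 → 0 < energy S ξ)
    (hNP : Module.finrank ℂ N + Module.finrank ℂ P = Module.finrank ℂ W)
    {Hm Hp : Submodule ℂ W}
    (hHm : ∀ a, a ∈ Hm ↔
      ∃ ξ : ℝ → W, (∀ x, HasDerivAt ξ (M x (ξ x)) x) ∧ ξ 0 = a ∧ Tendsto ξ atBot (𝓝 0))
    (hHp : ∀ a, a ∈ Hp ↔
      ∃ ξ : ℝ → W, (∀ x, HasDerivAt ξ (M x (ξ x)) x) ∧ ξ 0 = a ∧ Tendsto ξ atTop (𝓝 0)) :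
    Module.finrank ℂ Hm = Module.finrank ℂ P ∧ Module.finrank ℂ Hp = Module.finrank ℂ N ∧
      Hm ⊓ Hp = ⊥ := by
  -- The reflection x ↦ -x exchanges the two ends; it replaces M(x) by -M(-x) and S by -S, preserves
  -- the Lyapunov condition and swaps the roles of N and P.
  have hneg : ∀ a, energy (-S) a = -energy S a := fun a => by simp [energy]
  have hle : ∀ (T : W →L[ℂ] W) (L : Submodule ℂ W), (∀ ξ ∈ L, ξ ≠ 0 → energy T ξ < 0) →
      ∀ ξ ∈ L, energy T ξ ≤ 0 := fun T L h ξ hξ => by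
    rcases eq_or_ne ξ 0 with rfl | h0
    · simp [energy]
    · exact (h ξ hξ h0).le
  have hS' : (-S).IsSymmetric := fun a b => by
    have := hS a b
    simpa using this
  have hE' : ∀ x ξ, δ * ‖ξ‖ ^ 2 ≤ (inner ℂ ((-S) ξ) ((-M (-x)) ξ)).re := fun x ξ => by
    simpa using hE (-x) ξ
  have hP' : ∀ ξ ∈ P, ξ ≠ 0 → energy (-S) ξ < 0 := fun ξ h h0 => by
    simpa [hneg] using hP ξ h h0
  have hrefl : ∀ {ξ : ℝ → W} {A : ℝ → W →L[ℂ] W}, (∀ x, HasDerivAt ξ (A x (ξ x)) x) →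
      ∀ x, HasDerivAt (fun x => ξ (-x)) ((-A (-x)) (ξ (-x))) x := fun {ξ A} h x => by
    have := (h (-x)).scomp x (hasDerivAt_neg x)
    simpa [Function.comp_def] using this
  have hHm' : ∀ a, a ∈ Hm ↔ ∃ ξ : ℝ → W, (∀ x, HasDerivAt ξ ((-M (-x)) (ξ x)) x) ∧ ξ 0 = a ∧
      Tendsto ξ atTop (𝓝 0) := fun a => by
    rw [hHm]
    constructor
    · rintro ⟨ξ, h1, h2, h3⟩
      exact ⟨fun x => ξ (-x), hrefl h1, by simpa using h2, h3.comp tendsto_neg_atTop_atBot⟩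
    · rintro ⟨ξ, h1, h2, h3⟩
      refine ⟨fun x => ξ (-x), fun x => ?_, by simpa using h2, h3.comp tendsto_neg_atBot_atTop⟩
      simpa using hrefl (A := fun x => -M (-x)) h1 x
  refine ⟨finrank_decaying (M := fun x => -M (-x)) (hM.comp continuous_neg).neg (K := K)
      (fun x => by simpa using hK (-x)) hS' hδ hE' (hle _ P hP')
      (fun ξ h h0 => by simpa [hneg] using hN ξ h h0) (by omega) hHm',
    finrank_decaying hM hK hS hδ hE (hle _ N hN) hP hNP hHp, ?_⟩
  rw [eq_bot_iff]
  rintro a ⟨ham, hap⟩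
  by_contra hne
  obtain ⟨ξ, h1, h2, h3⟩ := (hHp a).1 hap
  obtain ⟨η, k1, k2, k3⟩ := (hHm' a).1 ham
  have e1 := energy_neg_of_tendsto hS hδ hE h1 h3 (by rwa [h2])
  have e2 := energy_neg_of_tendsto (M := fun x => -M (-x)) hS' hδ hE' k1 k3 (by rwa [k2])
  rw [h2] at e1
  rw [k2, hneg] at e2
  linarith

end Dichotomy

/-! ### Construction of the Lyapunov form -/

section Lyapunov

variable {V : Type*} [NormedAddCommGroup V] [InnerProductSpace ℂ V]

/-- The operator on `V × V` with the block matrix `[[a, b], [c, d]]`. -/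
noncomputable def blockOp (a b c d : V →L[ℂ] V) : WithLp 2 (V × V) →L[ℂ] WithLp 2 (V × V) :=
  (WithLp.prodContinuousLinearEquiv 2 ℂ V V).symm.toContinuousLinearMap ∘L
    (.inl ℂ V V ∘L (a ∘L .fst ℂ V V + b ∘L .snd ℂ V V) +
      .inr ℂ V V ∘L (c ∘L .fst ℂ V V + d ∘L .snd ℂ V V)) ∘L
    (WithLp.prodContinuousLinearEquiv 2 ℂ V V).toContinuousLinearMap

@[simp] theorem blockOp_fst (a b c d : V →L[ℂ] V) (ξ : WithLp 2 (V × V)) :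
    (blockOp a b c d ξ).fst = a ξ.fst + b ξ.snd :=
  add_zero _

@[simp] theorem blockOp_snd (a b c d : V →L[ℂ] V) (ξ : WithLp 2 (V × V)) :
    (blockOp a b c d ξ).snd = c ξ.fst + d ξ.snd :=
  zero_add _

theorem inner_withLp_prod (ξ η : WithLp 2 (V × V)) :
    inner ℂ ξ η = inner ℂ ξ.fst η.fst + inner ℂ ξ.snd η.snd := rfl

/-- The coefficient operator of `p' = A p + κ w`, `w' = (κ + B) p`. -/
noncomputable def modeOp (κ : ℂ) (A B : V →L[ℂ] V) : WithLp 2 (V × V) →L[ℂ] WithLp 2 (V × V) :=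
  blockOp A (κ • .id ℂ V) (κ • .id ℂ V + B) 0

theorem continuous_modeOp {X : Type*} [TopologicalSpace X] (κ : ℂ) {A B : X → V →L[ℂ] V}
    (hA : Continuous A) (hB : Continuous B) : Continuous fun x => modeOp κ (A x) (B x) := by
  unfold modeOp blockOp
  fun_prop

theorem norm_modeOp_le (κ : ℂ) (A B : V →L[ℂ] V) :
    ‖modeOp κ A B‖ ≤ ‖A‖ + ‖κ‖ + (‖κ‖ + ‖B‖) := by
  refine ContinuousLinearMap.opNorm_le_bound _ (by positivity) fun ξ => ?_
  have hsq : ∀ η : WithLp 2 (V × V), ‖η‖ ^ 2 = ‖η.fst‖ ^ 2 + ‖η.snd‖ ^ 2 :=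
    WithLp.prod_norm_sq_eq_of_L2
  have h1 : ‖ξ.fst‖ ≤ ‖ξ‖ := WithLp.norm_fst_le _ ξ
  have h2 : ‖ξ.snd‖ ≤ ‖ξ‖ := WithLp.norm_snd_le _ ξ
  have h3 : ∀ η : WithLp 2 (V × V), ‖η‖ ≤ ‖η.fst‖ + ‖η.snd‖ := fun η =>
    abs_le_of_sq_le_sq' (by rw [hsq η]; nlinarith [norm_nonneg η.fst, norm_nonneg η.snd])
      (by positivity) |>.2
  have h4 : ‖(modeOp κ A B ξ).fst‖ ≤ (‖A‖ + ‖κ‖) * ‖ξ‖ := by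
    have : (modeOp κ A B ξ).fst = A ξ.fst + κ • ξ.snd := by simp [modeOp]
    rw [this, add_mul]
    refine (norm_add_le _ _).trans (add_le_add (A.le_opNorm_of_le h1) ?_)
    rw [norm_smul]
    exact mul_le_mul_of_nonneg_left h2 (norm_nonneg _)
  have h5 : ‖(modeOp κ A B ξ).snd‖ ≤ (‖κ‖ + ‖B‖) * ‖ξ‖ := by
    have : (modeOp κ A B ξ).snd = κ • ξ.fst + B ξ.fst := by simp [modeOp]
    rw [this, add_mul]
    refine (norm_add_le _ _).trans (add_le_add ?_ (B.le_opNorm_of_le h1))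
    rw [norm_smul]
    exact mul_le_mul_of_nonneg_left h1 (norm_nonneg _)
  linarith [h3 (modeOp κ A B ξ)]

/-- The symmetric operator of the Lyapunov form
`⟨u, R u⟩ - ⟨z, T z⟩ + 2 Re ⟨p, σ w⟩`, `u = p + w`, `z = p - w`. -/
noncomputable def lyapOp (R T : V →L[ℂ] V) (σ : ℂ) : WithLp 2 (V × V) →L[ℂ] WithLp 2 (V × V) :=
  blockOp (R - T) (R + T + σ • .id ℂ V) (R + T + (starRingEnd ℂ σ) • .id ℂ V) (R - T)

theorem lyapOp_isSymmetric {R T : V →L[ℂ] V} (hR : R.IsSymmetric) (hT : T.IsSymmetric) (σ : ℂ) :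
    (lyapOp R T σ).IsSymmetric := by
  intro ξ η
  have hR' : ∀ a b, inner ℂ (R a) b = inner ℂ a (R b) := hR
  have hT' : ∀ a b, inner ℂ (T a) b = inner ℂ a (T b) := hT
  change inner ℂ (lyapOp R T σ ξ) η = inner ℂ ξ (lyapOp R T σ η)
  simp only [lyapOp, inner_withLp_prod, blockOp_fst, blockOp_snd, _root_.add_apply,
    _root_.sub_apply, _root_.smul_apply, ContinuousLinearMap.id_apply,
    inner_add_left, inner_add_right, inner_sub_left, inner_sub_right, inner_smul_left,
    inner_smul_right, hR', hT', Complex.conj_conj]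
  ring

/-- Here z = 0 and u = 2p, so only R and the cross term contribute. On the antidiagonal u = 0 and z
= 2p, leaving T and the cross term with reversed sign. -/
theorem energy_lyapOp_diag (R T : V →L[ℂ] V) (σ : ℂ) (p : V) :
    energy (lyapOp R T σ) (WithLp.toLp 2 (p, p)) =
      4 * (inner ℂ p (R p)).re + 2 * σ.re * ‖p‖ ^ 2 := by
  have h : inner ℂ p p = ((‖p‖ ^ 2 : ℝ) : ℂ) := by
    rw [inner_self_eq_norm_sq_to_K]; norm_cast
  simp only [energy, lyapOp, inner_withLp_prod, blockOp_fst, blockOp_snd, WithLp.toLp_fst,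
    WithLp.toLp_snd, _root_.add_apply, _root_.sub_apply,
    _root_.smul_apply, ContinuousLinearMap.id_apply, inner_add_right,
    inner_sub_right, inner_smul_right, h, Complex.add_re, Complex.sub_re, Complex.re_mul_ofReal,
    Complex.conj_re]
  ring

theorem energy_lyapOp_antidiag (R T : V →L[ℂ] V) (σ : ℂ) (p : V) :
    energy (lyapOp R T σ) (WithLp.toLp 2 (p, -p)) =
      -(4 * (inner ℂ p (T p)).re + 2 * σ.re * ‖p‖ ^ 2) := by
  have h : inner ℂ p p = ((‖p‖ ^ 2 : ℝ) : ℂ) := by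
    rw [inner_self_eq_norm_sq_to_K]; norm_cast
  simp only [energy, lyapOp, inner_withLp_prod, blockOp_fst, blockOp_snd, WithLp.toLp_fst,
    WithLp.toLp_snd, _root_.add_apply, _root_.sub_apply,
    _root_.smul_apply, ContinuousLinearMap.id_apply, inner_add_right,
    inner_sub_right, inner_smul_right, inner_neg_left, inner_neg_right, map_neg, mul_neg, h,
    Complex.add_re, Complex.sub_re, Complex.neg_re, Complex.re_mul_ofReal, Complex.conj_re]
  ring

theorem neg_norm_mul_norm_le_re_inner (a b : V) : -(‖a‖ * ‖b‖) ≤ (inner ℂ a b).re :=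
  (neg_le_neg (norm_inner_le_norm (𝕜 := ℂ) a b)).trans
    ((neg_le_neg (Complex.abs_re_le_norm _)).trans (neg_abs_le _))

/-- Since R is symmetric, ⟨u, Ru⟩ is real, and the κ-term contributes Re κ ⟨u, Ru⟩ ≥ 0. Applied to
(R, A₀ + B₀, u) and to (T, B₀ - A₀, z). -/
theorem two_mul_re_inner_le {R D : V →L[ℂ] V} (hR : R.IsSymmetric)
    (hR0 : ∀ u, 0 ≤ (inner ℂ u (R u)).re) (hRD : ∀ p, R (D p) = (2 : ℂ) • p) {κ : ℂ}
    (hκ : 0 ≤ κ.re) (u p : V) :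
    2 * (inner ℂ u p).re ≤ (inner ℂ (R u) (D p + κ • u)).re := by
  have hR' : ∀ a b, inner ℂ (R a) b = inner ℂ a (R b) := hR
  have him : (inner ℂ u (R u)).im = 0 := by
    have h := inner_conj_symm (𝕜 := ℂ) u (R u)
    rw [hR'] at h
    exact Complex.conj_eq_iff_im.1 h
  rw [hR', map_add, hRD, map_smul, inner_add_right, inner_smul_right, inner_smul_right]
  simp only [Complex.add_re, Complex.mul_re, him, Complex.re_ofNat, Complex.im_ofNat]
  nlinarith [mul_nonneg hκ (hR0 u)]

/-- The six terms are the u- and z-parts at the reference coefficients, the two halves of the cross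
term there, and the errors from A - A₀ and B - B₀. -/
theorem re_inner_lyapOp_modeOp (R T A₀ B₀ A B : V →L[ℂ] V) (σ κ : ℂ) (p w : V) :
    (inner ℂ (lyapOp R T σ (WithLp.toLp 2 (p, w))) (modeOp κ A B (WithLp.toLp 2 (p, w)))).re =
      (inner ℂ (R (p + w)) ((A₀ + B₀) p + κ • (p + w))).re +
      (inner ℂ (T (p - w)) ((B₀ - A₀) p + κ • (p - w))).re +
      (inner ℂ (σ • w) (A₀ p + κ • w)).re +
      (inner ℂ ((starRingEnd ℂ σ) • p) (κ • p + B₀ p)).re +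
      (inner ℂ (R (p + w) - T (p - w) + σ • w) ((A - A₀) p)).re +
      (inner ℂ (R (p + w) + T (p - w) + (starRingEnd ℂ σ) • p) ((B - B₀) p)).re := by
  simp only [← Complex.add_re]
  congr 1
  simp only [lyapOp, modeOp, inner_withLp_prod, blockOp_fst, blockOp_snd, WithLp.toLp_fst,
    WithLp.toLp_snd, _root_.add_apply, _root_.sub_apply,
    _root_.smul_apply, ContinuousLinearMap.id_apply, _root_.zero_apply,
    map_add, map_sub, smul_add, smul_sub, inner_add_left, inner_add_right, inner_sub_left,
    inner_sub_right, inner_smul_left, inner_smul_right, inner_zero_right, Complex.conj_conj]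
  ring

/-- The gain of the cross term: σ parallel to κ makes ⟨σw, κw⟩ equal to m‖w‖². -/
theorem re_inner_smul_add_ge {σ κ : ℂ} {η m : ℝ} (hσ : ‖σ‖ = η)
    (hσκ : (starRingEnd ℂ σ) * κ = (m : ℂ)) (A : V →L[ℂ] V) (p w : V) :
    m * ‖w‖ ^ 2 - η * ‖A‖ * (‖w‖ * ‖p‖) ≤ (inner ℂ (σ • w) (A p + κ • w)).re := by
  have e1 : inner ℂ (σ • w) (κ • w) = ((m * ‖w‖ ^ 2 : ℝ) : ℂ) := by
    rw [inner_smul_left, inner_smul_right, ← mul_assoc, hσκ, inner_self_eq_norm_sq_to_K]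
    push_cast
    rfl
  have e2 := neg_norm_mul_norm_le_re_inner (σ • w) (A p)
  have e3 : ‖σ • w‖ * ‖A p‖ ≤ η * ‖w‖ * (‖A‖ * ‖p‖) := by
    rw [norm_smul, hσ]
    exact mul_le_mul_of_nonneg_left (A.le_opNorm p) (by rw [← hσ]; positivity)
  rw [inner_add_right, e1, Complex.add_re, Complex.ofReal_re]
  linarith

/-- The price of the cross term, a multiple of ‖p‖² to be absorbed by 4‖p‖². -/
theorem re_inner_conj_smul_add_ge {σ : ℂ} {η : ℝ} (hσ : ‖σ‖ = η) (κ : ℂ) (B : V →L[ℂ] V) (p : V) :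
    -((η * ‖κ‖ + η * ‖B‖) * ‖p‖ ^ 2) ≤ (inner ℂ ((starRingEnd ℂ σ) • p) (κ • p + B p)).re := by
  have e2 := neg_norm_mul_norm_le_re_inner ((starRingEnd ℂ σ) • p) (κ • p + B p)
  have e3 : ‖(starRingEnd ℂ σ) • p‖ * ‖κ • p + B p‖ ≤
      η * ‖p‖ * (‖κ‖ * ‖p‖ + ‖B‖ * ‖p‖) := by
    rw [norm_smul, RCLike.norm_conj, hσ]
    refine mul_le_mul_of_nonneg_left ((norm_add_le _ _).trans ?_) (by rw [← hσ]; positivity)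
    rw [norm_smul]
    exact add_le_add_right (B.le_opNorm p) _
  linarith

theorem re_inner_apply_ge {C c : ℝ} (hC : 0 < C) (hc : 0 ≤ c) {y p w : V} {D : V →L[ℂ] V}
    (hy : ‖y‖ ≤ C * (‖p‖ + ‖w‖)) (hD : ‖D‖ ≤ c / (16 * C)) :
    -(c / 8 * (‖p‖ ^ 2 + ‖w‖ ^ 2)) ≤ (inner ℂ y (D p)).re := by
  have e1 := neg_norm_mul_norm_le_re_inner y (D p)
  have e2 : ‖y‖ * ‖D p‖ ≤ C * (‖p‖ + ‖w‖) * (c / (16 * C) * ‖p‖) :=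
    mul_le_mul hy (D.le_of_opNorm_le hD p) (norm_nonneg _) (by positivity)
  have e3 : C * (‖p‖ + ‖w‖) * (c / (16 * C) * ‖p‖) = c / 16 * ((‖p‖ + ‖w‖) * ‖p‖) := by
    field_simp
  have e4 : (‖p‖ + ‖w‖) * ‖p‖ ≤ 2 * (‖p‖ ^ 2 + ‖w‖ ^ 2) := by
    nlinarith [sq_nonneg (‖p‖ - ‖w‖)]
  have e5 := mul_le_mul_of_nonneg_left e4 (by positivity : 0 ≤ c / 16)
  linarith

/-- A Lyapunov form for `p' = A p + κ w`, `w' = (κ + B) p` with constants that are uniform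
for `Re κ ≥ 0`, `|κ| ≥ r` and for `(A, B)` near `(A₀, B₀)`. -/
theorem exists_uniform_lyapunov {A₀ B₀ R T : V →L[ℂ] V}
    (hR : R.IsSymmetric) (hT : T.IsSymmetric)
    (hRpos : ∀ p, p ≠ 0 → 0 < (inner ℂ p (R p)).re) (hTpos : ∀ p, p ≠ 0 → 0 < (inner ℂ p (T p)).re)
    (hRA : ∀ p, R ((A₀ + B₀) p) = (2 : ℂ) • p) (hTA : ∀ p, T ((B₀ - A₀) p) = (2 : ℂ) • p)
    {r : ℝ} (hr : 0 < r) :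
    ∃ ρ > 0, ∃ δ > 0, ∀ κ : ℂ, 0 ≤ κ.re → r ≤ ‖κ‖ →
      ∃ S : WithLp 2 (V × V) →L[ℂ] WithLp 2 (V × V), S.IsSymmetric ∧
        (∀ p : V, p ≠ 0 → 0 < energy S (WithLp.toLp 2 (p, p))) ∧
        (∀ p : V, p ≠ 0 → energy S (WithLp.toLp 2 (p, -p)) < 0) ∧
        ∀ A B : V →L[ℂ] V, ‖A - A₀‖ ≤ ρ → ‖B - B₀‖ ≤ ρ → ∀ ξ,
          δ * ‖ξ‖ ^ 2 ≤ (inner ℂ (S ξ) (modeOp κ A B ξ)).re := by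
  set a := ‖A₀‖
  set b := ‖B₀‖
  have ha : 0 ≤ a := norm_nonneg _
  have hb : 0 ≤ b := norm_nonneg _
  set C := ‖R‖ + ‖T‖ + 1
  have hC : 0 < C := by positivity
  -- The three summands ensure m + ηb ≤ θ(1 + b) ≤ 1 and ηa² ≤ θa² ≤ r ≤ ‖κ‖, so that both losses of
  -- the cross term are absorbed.
  set θ : ℝ := 1 / (1 + b + a ^ 2 / r) with hθ
  have hden : 0 < 1 + b + a ^ 2 / r := by positivity
  have hθ0 : 0 < θ := by positivity
  have hθm : θ * (1 + b + a ^ 2 / r) = 1 := by rw [hθ]; field_simp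
  have hθar : 0 ≤ θ * (a ^ 2 / r) := by positivity
  have hθb : 0 ≤ θ * b := by positivity
  set m₀ : ℝ := θ * (r / (1 + r)) with hm₀
  have hm₀0 : 0 < m₀ := by positivity
  have nn : ∀ {S : V →L[ℂ] V}, (∀ p, p ≠ 0 → 0 < (inner ℂ p (S p)).re) →
      ∀ p, 0 ≤ (inner ℂ p (S p)).re := fun {S} h p => by
    rcases eq_or_ne p 0 with rfl | h0
    · simp
    · exact (h p h0).le
  refine ⟨m₀ / (16 * C), by positivity, m₀ / 4, by positivity, fun κ hκ hκr => ?_⟩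
  have hκ0 : 0 < ‖κ‖ := hr.trans_le hκr
  -- Dividing by 1 + ‖κ‖ keeps both η = ‖σ‖ and m = η‖κ‖ below θ for arbitrarily large κ, while m ≥
  -- m₀ because ‖κ‖ ≥ r.
  set η : ℝ := θ / (1 + ‖κ‖) with hη
  have hη0 : 0 < η := by positivity
  set m : ℝ := η * ‖κ‖ with hm
  have hm0 : 0 < m := by positivity
  have hηm : η + m = θ := by rw [hm, hη]; field_simp
  have hmm₀ : m₀ ≤ m := by
    have e : m = θ * (‖κ‖ / (1 + ‖κ‖)) := by rw [hm, hη]; ring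
    rw [e, hm₀]
    refine mul_le_mul_of_nonneg_left ?_ hθ0.le
    rw [div_le_div_iff₀ (by positivity) (by positivity)]
    nlinarith
  set σ : ℂ := ((η / ‖κ‖ : ℝ) : ℂ) * κ with hσ
  have hσn : ‖σ‖ = η := by
    rw [hσ, norm_mul, Complex.norm_real, Real.norm_of_nonneg (by positivity)]
    field_simp
  have hσκ : (starRingEnd ℂ σ) * κ = (m : ℂ) := by
    rw [hσ, map_mul, Complex.conj_ofReal, mul_assoc, mul_comm (starRingEnd ℂ κ),
      Complex.mul_conj, Complex.normSq_eq_norm_sq, ← Complex.ofReal_mul, hm]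
    congr 1
    field_simp
  have hσre : 0 ≤ σ.re := by
    rw [hσ, Complex.re_ofReal_mul]
    positivity
  refine ⟨lyapOp R T σ, lyapOp_isSymmetric hR hT σ, fun p hp => ?_, fun p hp => ?_, ?_⟩
  · rw [energy_lyapOp_diag]
    have := hRpos p hp
    positivity
  · rw [energy_lyapOp_antidiag, neg_lt_zero]
    have := hTpos p hp
    positivity
  intro A B hA hB ξ
  obtain ⟨⟨p, w⟩⟩ := ξ
  rw [re_inner_lyapOp_modeOp R T A₀ B₀, WithLp.prod_norm_sq_eq_of_L2]
  simp only [WithLp.toLp_fst, WithLp.toLp_snd]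
  have h1 := two_mul_re_inner_le hR (nn hRpos) hRA hκ (p + w) p
  have h2 := two_mul_re_inner_le hT (nn hTpos) hTA hκ (p - w) p
  have h12 : 2 * (inner ℂ (p + w) p).re + 2 * (inner ℂ (p - w) p).re = 4 * ‖p‖ ^ 2 := by
    have h : (inner ℂ p p).re = ‖p‖ ^ 2 := inner_self_eq_norm_sq (𝕜 := ℂ) p
    rw [inner_add_left, inner_sub_left, Complex.add_re, Complex.sub_re, h]
    ring
  have hp0 := norm_nonneg p
  have hw0 := norm_nonneg w
  have h3 := re_inner_smul_add_ge hσn hσκ A₀ p w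
  have h4 := re_inner_conj_smul_add_ge hσn κ B₀ p
  rw [← hm] at h4
  have hηθ : η ≤ θ := by linarith
  have hη1 : η ≤ 1 := by linarith
  have pert := fun y D => re_inner_apply_ge (y := y) (D := D) (p := p) (w := w) hC hm₀0.le
  have hu : ‖R (p + w)‖ ≤ ‖R‖ * (‖p‖ + ‖w‖) :=
    (R.le_opNorm _).trans (mul_le_mul_of_nonneg_left (norm_add_le _ _) (norm_nonneg _))
  have hz : ‖T (p - w)‖ ≤ ‖T‖ * (‖p‖ + ‖w‖) :=
    (T.le_opNorm _).trans (mul_le_mul_of_nonneg_left (norm_sub_le _ _) (norm_nonneg _))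
  have h5 := pert (R (p + w) - T (p - w) + σ • w) (A - A₀) (by
    have e := norm_add_le (R (p + w) - T (p - w)) (σ • w)
    have e' := norm_sub_le (R (p + w)) (T (p - w))
    have e'' : ‖σ • w‖ ≤ ‖w‖ := by
      rw [norm_smul, hσn]; exact mul_le_of_le_one_left hw0 hη1
    simp only [C, add_mul, one_mul]
    linarith) hA
  have h6 := pert (R (p + w) + T (p - w) + (starRingEnd ℂ σ) • p) (B - B₀) (by
    have e := norm_add_le (R (p + w) + T (p - w)) ((starRingEnd ℂ σ) • p)
    have e' := norm_add_le (R (p + w)) (T (p - w))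
    have e'' : ‖(starRingEnd ℂ σ) • p‖ ≤ ‖p‖ := by
      rw [norm_smul, RCLike.norm_conj, hσn]; exact mul_le_of_le_one_left hp0 hη1
    simp only [C, add_mul, one_mul]
    linarith) hB
  have h7 : η * a * (‖w‖ * ‖p‖) ≤ m / 2 * ‖w‖ ^ 2 + 1 / 2 * ‖p‖ ^ 2 := by
    have e1 : η * a ^ 2 ≤ ‖κ‖ := by
      have : θ * (a ^ 2 / r) ≤ 1 := by linarith
      rw [← mul_div_assoc, div_le_one hr] at this
      have := mul_le_mul_of_nonneg_right hηθ (sq_nonneg a)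
      linarith
    have e2 : (η * a) ^ 2 ≤ m := by
      calc (η * a) ^ 2 = η * (η * a ^ 2) := by ring
        _ ≤ η * ‖κ‖ := mul_le_mul_of_nonneg_left e1 hη0.le
        _ = m := hm.symm
    have e3 := mul_le_mul_of_nonneg_right e2 (sq_nonneg ‖w‖)
    have e4 := two_mul_le_add_sq (η * a * ‖w‖) ‖p‖
    rw [mul_pow] at e4
    linarith
  have hmb : m + η * b ≤ 1 := by
    have : η * b ≤ θ * b := mul_le_mul_of_nonneg_right hηθ hb
    linarith
  have h8 : (m + η * b) * ‖p‖ ^ 2 ≤ ‖p‖ ^ 2 := mul_le_of_le_one_left (sq_nonneg _) hmb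
  have h9 : m₀ / 2 * ‖w‖ ^ 2 ≤ m / 2 * ‖w‖ ^ 2 :=
    mul_le_mul_of_nonneg_right (by linarith) (sq_nonneg _)
  have h10 : m₀ / 2 * ‖p‖ ^ 2 ≤ ‖p‖ ^ 2 :=
    mul_le_of_le_one_left (sq_nonneg _) (by linarith)
  have h11 : 0 ≤ ‖p‖ ^ 2 := sq_nonneg _
  -- Balance: the ‖p‖² coefficient is at least 4 - 1/2 - 1 - m₀/4, the ‖w‖² coefficient at least m/2
  -- - m₀/4; each perturbation costs m₀/8. Both exceed or equal m₀/4.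
  linarith

end Lyapunov

/-! ### The boosted coefficients and the subcharacteristic condition -/

section Coefficients

/-- The operator on `ℂⁿ` of a real matrix. -/
noncomputable def complexOp {n : ℕ} (F : Matrix (Fin n) (Fin n) ℝ) :
    EuclideanSpace ℂ (Fin n) →L[ℂ] EuclideanSpace ℂ (Fin n) :=
  Matrix.toEuclideanCLM (n := Fin n) (𝕜 := ℂ) (F.map Complex.ofReal)

variable {n : ℕ}

theorem complexOp_apply (F : Matrix (Fin n) (Fin n) ℝ) (p : EuclideanSpace ℂ (Fin n)) :
    (complexOp F p).ofLp = F.map Complex.ofReal *ᵥ p.ofLp := rfl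

theorem complexOp_add (F G : Matrix (Fin n) (Fin n) ℝ) :
    complexOp (F + G) = complexOp F + complexOp G := by
  rw [complexOp, Matrix.map_add _ Complex.ofReal_add, map_add]; rfl

theorem complexOp_sub (F G : Matrix (Fin n) (Fin n) ℝ) :
    complexOp (F - G) = complexOp F - complexOp G := by
  rw [complexOp, Matrix.map_sub _ Complex.ofReal_sub, map_sub]; rfl

theorem continuous_complexOp :
    Continuous (complexOp : Matrix (Fin n) (Fin n) ℝ → _) := by
  have h1 : Continuous (fun G : Matrix (Fin n) (Fin n) ℂ =>
      Matrix.toEuclideanCLM (n := Fin n) (𝕜 := ℂ) G) :=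
    LinearMap.continuous_of_finiteDimensional
      ((Matrix.toEuclideanCLM (n := Fin n) (𝕜 := ℂ)).toAlgEquiv.toLinearMap)
  exact h1.comp (continuous_id.matrix_map Complex.continuous_ofReal)

theorem complexOp_isSymmetric {F : Matrix (Fin n) (Fin n) ℝ} (hF : F.IsHermitian) :
    (complexOp F).IsSymmetric := by
  refine Matrix.isSymmetric_toEuclideanLin_iff.2 ?_
  ext i j
  have := hF.apply i j
  simp only [star_trivial] at this
  simp [this]

/-- For p = a + ib with real a, b, the real part of ⟨p, Fp⟩ is a·Fa + b·Fb. -/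
theorem re_inner_complexOp_pos {F : Matrix (Fin n) (Fin n) ℝ} (hF : F.PosDef)
    {p : EuclideanSpace ℂ (Fin n)} (hp : p ≠ 0) : 0 < (inner ℂ p (complexOp F p)).re := by
  set a : Fin n → ℝ := fun i => (p i).re
  set b : Fin n → ℝ := fun i => (p i).im
  have h : (inner ℂ p (complexOp F p)).re = star a ⬝ᵥ F *ᵥ a + star b ⬝ᵥ F *ᵥ b := by
    simp only [PiLp.inner_apply, complexOp_apply, Matrix.mulVec, dotProduct, a, b,
      Matrix.map_apply, RCLike.inner_apply, Complex.re_sum, Complex.mul_re, Complex.im_sum,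
      Complex.mul_im, Complex.ofReal_re, Complex.ofReal_im, Complex.conj_re, Complex.conj_im,
      star_trivial, ← Finset.sum_add_distrib]
    refine Finset.sum_congr rfl fun i _ => ?_
    simp only [zero_mul, sub_zero, add_zero]
    ring
  have ha := hF.posSemidef.dotProduct_mulVec_nonneg a
  have hb := hF.posSemidef.dotProduct_mulVec_nonneg b
  rw [h]
  by_cases ha0 : a = 0
  · have hb0 : b ≠ 0 := fun hb0 => hp (by
      ext i
      exact Complex.ext (congrFun ha0 i) (congrFun hb0 i))
    have := hF.dotProduct_mulVec_pos hb0
    linarith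
  · have := hF.dotProduct_mulVec_pos ha0
    linarith

theorem exists_inverse_of_posDef {F : Matrix (Fin n) (Fin n) ℝ} (hF : F.PosDef) :
    ∃ R : EuclideanSpace ℂ (Fin n) →L[ℂ] EuclideanSpace ℂ (Fin n), R.IsSymmetric ∧
      (∀ p, p ≠ 0 → 0 < (inner ℂ p (R p)).re) ∧ ∀ p, R (complexOp F p) = (2 : ℂ) • p := by
  have hH : ((2 : ℝ) • F⁻¹).PosDef := hF.inv.smul (by norm_num)
  refine ⟨complexOp ((2 : ℝ) • F⁻¹), complexOp_isSymmetric hH.1,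
    fun p hp => re_inner_complexOp_pos hH hp, fun p => ?_⟩
  have hu : IsUnit F.det := F.isUnit_iff_isUnit_det.1 hF.isUnit
  have h : ((2 : ℝ) • F⁻¹).map Complex.ofReal * F.map Complex.ofReal =
      (2 : ℂ) • (1 : Matrix (Fin n) (Fin n) ℂ) := by
    have e := (Matrix.map_mul (f := Complex.ofRealHom) (L := (2 : ℝ) • F⁻¹) (M := F)).symm
    refine e.trans ?_
    rw [Matrix.smul_mul, Matrix.nonsing_inv_mul _ hu]
    ext i j
    by_cases hij : i = j <;> simp [hij]
  ext i
  have h2 : (complexOp ((2 : ℝ) • F⁻¹) (complexOp F p)).ofLp = (2 : ℂ) • p.ofLp := by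
    rw [complexOp_apply, complexOp_apply, Matrix.mulVec_mulVec, h, Matrix.smul_mulVec,
      Matrix.one_mulVec]
  exact congrFun h2 i

theorem jac_boostF {f g : Sp n → Sp n} {v : Sp n} (hf : DifferentiableAt ℝ f v)
    (hg : DifferentiableAt ℝ g v) (s : ℝ) :
    jac (boostF f g s) v = gam s • (jac f v - s • jac g v) := by
  have h : HasFDerivAt (boostF f g s) (gam s • (fderiv ℝ f v - s • fderiv ℝ g v)) v :=
    (hf.hasFDerivAt.sub (hg.hasFDerivAt.const_smul s)).const_smul (gam s)
  ext i j
  simp [jac, h.fderiv]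

theorem jac_boostG {f g : Sp n → Sp n} {v : Sp n} (hf : DifferentiableAt ℝ f v)
    (hg : DifferentiableAt ℝ g v) (s : ℝ) :
    jac (boostG f g s) v = gam s • (jac g v - s • jac f v) := by
  have h : HasFDerivAt (boostG f g s) (gam s • (fderiv ℝ g v - s • fderiv ℝ f v)) v :=
    (hg.hasFDerivAt.sub (hf.hasFDerivAt.const_smul s)).const_smul (gam s)
  ext i j
  simp [jac, h.fderiv]

theorem continuousOn_jac {Ω : Set (Sp n)} (hΩ : IsOpen Ω) {f : Sp n → Sp n}
    (hf : ContDiffOn ℝ ∞ f Ω) : ContinuousOn (jac f) Ω := by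
  have h := hf.continuousOn_fderiv_of_isOpen hΩ (by simp)
  refine continuousOn_pi.2 fun i => continuousOn_pi.2 fun j => ?_
  exact (EuclideanSpace.proj (𝕜 := ℝ) i).continuous.comp_continuousOn
    (h.clm_apply continuousOn_const)

theorem gam_pos {s : ℝ} (hs : |s| < 1) : 0 < gam s := by
  have : 0 < 1 - s ^ 2 := by
    have := (sq_lt_one_iff_abs_lt_one s).2 hs
    linarith
  exact inv_pos.2 (Real.sqrt_pos.2 this)

theorem continuousAt_gam {s : ℝ} (hs : |s| < 1) : ContinuousAt gam s := by
  have : Real.sqrt (1 - s ^ 2) ≠ 0 := (inv_pos.1 (gam_pos hs)).ne'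
  exact ContinuousAt.inv₀ (by fun_prop) this

/-- For an eigenvector r of μ = μₖ(0), (A4) gives (1 ± μ) r·Dg(0)r > 0, and r·Dg(0)r > 0. Hence the
Lorentz factor is regular near the reference speed. -/
theorem abs_charSpeed_lt_one {k : Fin n} {Ω : Set (Sp n)} {f g : Sp n → Sp n}
    (hA : StandingAssumptions k Ω f g) : |charSpeed f g k 0| < 1 := by
  have hspec : IsOrderedSpectrum (jac f 0) (jac g 0) (genEig (jac f 0) (jac g 0)) := by
    rw [genEig, dif_pos hA.simple]
    exact hA.simple.choose_spec
  obtain ⟨r, hr, hFr⟩ := hspec.2 k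
  change _ = charSpeed f g k 0 • _ at hFr
  have h0 := hA.posDef_g.dotProduct_mulVec_pos hr
  have h1 := hA.subchar_add.dotProduct_mulVec_pos hr
  have h2 := hA.subchar_sub.dotProduct_mulVec_pos hr
  rw [Matrix.add_mulVec, hFr, dotProduct_add, dotProduct_smul, smul_eq_mul] at h1
  rw [Matrix.sub_mulVec, hFr, dotProduct_sub, dotProduct_smul, smul_eq_mul] at h2
  rw [abs_lt]
  constructor <;> nlinarith

/-- The operator of the boosted coefficient `γ(s) (F(v) - s G(v))`. -/
noncomputable def boostedOp (F G : Sp n → Matrix (Fin n) (Fin n) ℝ) (y : ℝ × Sp n) :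
    EuclideanSpace ℂ (Fin n) →L[ℂ] EuclideanSpace ℂ (Fin n) :=
  complexOp (gam y.1 • (F y.2 - y.1 • G y.2))

theorem continuousAt_boostedOp {F G : Sp n → Matrix (Fin n) (Fin n) ℝ} {s : ℝ} (hs : |s| < 1)
    {v : Sp n} (hF : ContinuousAt F v) (hG : ContinuousAt G v) :
    ContinuousAt (boostedOp F G) (s, v) := by
  refine continuous_complexOp.continuousAt.comp ?_
  have h1 : ContinuousAt (fun y : ℝ × Sp n => gam y.1) (s, v) :=
    ContinuousAt.comp (x := (s, v)) (f := Prod.fst) (continuousAt_gam hs) continuousAt_fst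
  have h2 : ContinuousAt (fun y : ℝ × Sp n => F y.2) (s, v) :=
    ContinuousAt.comp (x := (s, v)) (f := Prod.snd) hF continuousAt_snd
  have h3 : ContinuousAt (fun y : ℝ × Sp n => G y.2) (s, v) :=
    ContinuousAt.comp (x := (s, v)) (f := Prod.snd) hG continuousAt_snd
  exact h1.smul (h2.sub (continuousAt_fst.smul h3))

theorem boostedOp_add_boostedOp (F G : Sp n → Matrix (Fin n) (Fin n) ℝ) (s : ℝ) (v : Sp n) :
    boostedOp F G (s, v) + boostedOp G F (s, v) =
      complexOp ((gam s * (1 - s)) • (G v + F v)) := by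
  rw [boostedOp, boostedOp, ← complexOp_add]
  congr 1
  module

theorem boostedOp_sub_boostedOp (F G : Sp n → Matrix (Fin n) (Fin n) ℝ) (s : ℝ) (v : Sp n) :
    boostedOp G F (s, v) - boostedOp F G (s, v) =
      complexOp ((gam s * (1 + s)) • (G v - F v)) := by
  rw [boostedOp, boostedOp, ← complexOp_sub]
  congr 1
  module

theorem continuous_boostedOp_comp {Ω : Set (Sp n)} {F G : Sp n → Matrix (Fin n) (Fin n) ℝ} {s : ℝ}
    (hs : |s| < 1) (hF : ∀ v ∈ Ω, ContinuousAt F v) (hG : ∀ v ∈ Ω, ContinuousAt G v)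
    {φ : ℝ → Sp n} (hφ : Continuous φ) (hφΩ : ∀ x, φ x ∈ Ω) :
    Continuous fun x => boostedOp F G (s, φ x) :=
  continuous_iff_continuousAt.2 fun x =>
    ContinuousAt.comp (x := x) (f := fun x => (s, φ x))
      (continuousAt_boostedOp hs (hF _ (hφΩ x)) (hG _ (hφΩ x)))
      (continuous_const.prodMk hφ).continuousAt

end Coefficients

/-! ### Transfer to the Evans bundles -/

section Transfer

variable {n : ℕ}

/-- The change of variables `(p, q) ↦ (p, κ⁻¹ q)`. -/
noncomputable def rescale {κ : ℂ} (hκ : κ ≠ 0) :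
    Ph n ≃ₗ[ℂ] WithLp 2 (EuclideanSpace ℂ (Fin n) × EuclideanSpace ℂ (Fin n)) where
  toFun ξ := WithLp.toLp 2 (WithLp.toLp 2 (ξ ∘ Sum.inl), WithLp.toLp 2 (κ⁻¹ • ξ ∘ Sum.inr))
  invFun η := Sum.elim η.fst.ofLp (κ • η.snd.ofLp)
  map_add' ξ η := by
    refine congrArg (WithLp.toLp 2) (Prod.ext ?_ ?_) <;> ext i <;> simp [mul_add]
  map_smul' c ξ := by
    refine congrArg (WithLp.toLp 2) (Prod.ext ?_ ?_) <;> ext i <;> simp [mul_left_comm]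
  left_inv ξ := by ext (i | i) <;> simp [hκ]
  right_inv η := by
    refine congrArg (WithLp.toLp 2) (Prod.ext ?_ ?_) <;> ext i <;> simp [hκ]

theorem rescale_modeMatrix {f g : Sp n → Sp n} {s : ℝ} {κ : ℂ} (hκ : κ ≠ 0) (v : Sp n)
    (ξ : Ph n) :
    rescale hκ (modeMatrix f g s κ v *ᵥ ξ) =
      modeOp κ (complexOp (jac (boostF f g s) v)) (complexOp (jac (boostG f g s) v))
        (rescale hκ ξ) := by
  refine congrArg (WithLp.toLp 2) (Prod.ext ?_ ?_)
  · ext i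
    simp [rescale, modeMatrix, Matrix.fromBlocks_mulVec, complexOp, hκ]
  · ext i
    simp [rescale, modeMatrix, Matrix.fromBlocks_mulVec, complexOp, Matrix.add_mulVec,
      Matrix.smul_mulVec, hκ]
    field_simp

theorem mem_map_decaySpace {W : Type*} [NormedAddCommGroup W] [InnerProductSpace ℂ W]
    {f g : Sp n → Sp n} {s : ℝ} {κ : ℂ} {φ : ℝ → Sp n} (e : Ph n ≃ₗ[ℂ] W) {M : ℝ → W →L[ℂ] W}
    (hM : ∀ x ξ, e (modeMatrix f g s κ (φ x) *ᵥ ξ) = M x (e ξ)) {l : Filter ℝ} (a : W) :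
    a ∈ (decaySpace f g s κ φ l).map e.toLinearMap ↔
      ∃ ξ : ℝ → W, (∀ x, HasDerivAt ξ (M x (ξ x)) x) ∧ ξ 0 = a ∧ Tendsto ξ l (𝓝 0) := by
  have : FiniteDimensional ℂ W := e.finiteDimensional
  let L : Ph n ≃L[ℂ] W := e.toContinuousLinearEquiv
  have hL : ∀ ξ, L ξ = e ξ := fun _ => rfl
  constructor
  · rintro ⟨_, ⟨ξ, h1, rfl, h3⟩, rfl⟩
    refine ⟨fun x => L (ξ x), fun x => ?_, rfl, ?_⟩
    · have := (L.toContinuousLinearMap.restrictScalars ℝ).hasFDerivAt.comp_hasDerivAt x (h1 x)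
      exact this.congr_deriv (hM x (ξ x))
    · simpa [Function.comp_def] using (L.continuous.tendsto 0).comp h3
  · rintro ⟨ξ, h1, rfl, h3⟩
    refine ⟨L.symm (ξ 0), ⟨fun x => L.symm (ξ x), fun x => ?_, rfl, ?_⟩, L.apply_symm_apply _⟩
    · have := (L.symm.toContinuousLinearMap.restrictScalars ℝ).hasFDerivAt.comp_hasDerivAt x (h1 x)
      refine this.congr_deriv (L.injective ((L.apply_symm_apply _).trans ?_))
      rw [hL, hM, ← hL, L.apply_symm_apply]
    · simpa [Function.comp_def] using (L.symm.continuous.tendsto 0).comp h3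

/-- Dimensions and transversality of the Evans fibres, from a Lyapunov form in transformed
coordinates. -/
theorem evans_dichotomy {W : Type*} [NormedAddCommGroup W] [InnerProductSpace ℂ W]
    {f g : Sp n → Sp n} {s : ℝ} {κ : ℂ} {φ : ℝ → Sp n} (e : Ph n ≃ₗ[ℂ] W) {M : ℝ → W →L[ℂ] W}
    (hM : ∀ x ξ, e (modeMatrix f g s κ (φ x) *ᵥ ξ) = M x (e ξ)) (hMc : Continuous M)
    {K : ℝ} (hK : ∀ x, ‖M x‖ ≤ K) {S : W →L[ℂ] W} (hS : S.IsSymmetric)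
    {δ : ℝ} (hδ : 0 < δ) (hE : ∀ x ξ, δ * ‖ξ‖ ^ 2 ≤ (inner ℂ (S ξ) (M x ξ)).re)
    {N P : Submodule ℂ W} (hN : ∀ ξ ∈ N, ξ ≠ 0 → energy S ξ < 0)
    (hP : ∀ ξ ∈ P, ξ ≠ 0 → 0 < energy S ξ)
    (hNn : Module.finrank ℂ N = n) (hPn : Module.finrank ℂ P = n) :
    Module.finrank ℂ (evansMinus f g s φ κ) = n ∧ Module.finrank ℂ (evansPlus f g s φ κ) = n ∧
      evansMinus f g s φ κ ⊓ evansPlus f g s φ κ = ⊥ := by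
  have : FiniteDimensional ℂ W := e.finiteDimensional
  have hW : Module.finrank ℂ W = n + n := by
    rw [← e.finrank_eq]
    simp
  obtain ⟨h1, h2, h3⟩ := decaying_dichotomy hMc hK hS hδ hE hN hP (by rw [hNn, hPn, hW])
    (mem_map_decaySpace e hM (l := atBot)) (mem_map_decaySpace e hM (l := atTop))
  rw [LinearEquiv.finrank_map_eq] at h1 h2
  rw [← Submodule.map_inf _ e.injective, Submodule.map_eq_bot_iff] at h3
  exact ⟨h1.trans hPn, h2.trans hNn, h3⟩

/-- The graph of `c • id` in `V × V` has the dimension of `V`. -/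
theorem finrank_graph_smul {V : Type*} [NormedAddCommGroup V] [InnerProductSpace ℂ V]
    (c : ℂ) :
    ∃ N : Submodule ℂ (WithLp 2 (V × V)), Module.finrank ℂ N = Module.finrank ℂ V ∧
      ∀ ξ ∈ N, ∃ p : V, ξ = WithLp.toLp 2 (p, c • p) := by
  let j : V →ₗ[ℂ] WithLp 2 (V × V) :=
    (WithLp.linearEquiv 2 ℂ (V × V)).symm.toLinearMap ∘ₗ LinearMap.prod .id (c • .id)
  have hj : Function.Injective j := fun p q h => congrArg WithLp.fst h
  refine ⟨LinearMap.range j, LinearMap.finrank_range_of_inj hj, ?_⟩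
  rintro _ ⟨p, rfl⟩
  exact ⟨p, rfl⟩

/-- Dimensions and transversality of the Evans fibres, from a Lyapunov form that is valid for all
coefficients near `(A₀, B₀)`. -/
theorem evans_dichotomy_of_near {f g : Sp n → Sp n} {s : ℝ} {κ : ℂ} {φ : ℝ → Sp n}
    {V : Type*} [NormedAddCommGroup V] [InnerProductSpace ℂ V] [FiniteDimensional ℂ V]
    (hV : Module.finrank ℂ V = n) (e : Ph n ≃ₗ[ℂ] WithLp 2 (V × V))
    {A₀ B₀ : V →L[ℂ] V} {A B : ℝ → V →L[ℂ] V}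
    (hM : ∀ x ξ, e (modeMatrix f g s κ (φ x) *ᵥ ξ) = modeOp κ (A x) (B x) (e ξ))
    (hAc : Continuous A) (hBc : Continuous B) {ρ δ : ℝ} (hδ : 0 < δ)
    (hAρ : ∀ x, ‖A x - A₀‖ ≤ ρ) (hBρ : ∀ x, ‖B x - B₀‖ ≤ ρ)
    {S : WithLp 2 (V × V) →L[ℂ] WithLp 2 (V × V)} (hS : S.IsSymmetric)
    (hpos : ∀ p : V, p ≠ 0 → 0 < energy S (WithLp.toLp 2 (p, p)))
    (hneg : ∀ p : V, p ≠ 0 → energy S (WithLp.toLp 2 (p, -p)) < 0)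
    (hE : ∀ A B : V →L[ℂ] V,
      ‖A - A₀‖ ≤ ρ → ‖B - B₀‖ ≤ ρ → ∀ ξ, δ * ‖ξ‖ ^ 2 ≤ (inner ℂ (S ξ) (modeOp κ A B ξ)).re) :
    Module.finrank ℂ (evansMinus f g s φ κ) = n ∧ Module.finrank ℂ (evansPlus f g s φ κ) = n ∧
      evansMinus f g s φ κ ⊓ evansPlus f g s φ κ = ⊥ := by
  obtain ⟨P, hPn, hP⟩ := finrank_graph_smul (V := V) 1
  obtain ⟨N, hNn, hN⟩ := finrank_graph_smul (V := V) (-1)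
  rw [hV] at hPn hNn
  have hbound : ∀ {D D₀ : V →L[ℂ] V}, ‖D - D₀‖ ≤ ρ → ‖D‖ ≤ ‖D₀‖ + ρ := fun {D D₀} h => by
    linarith [norm_sub_norm_le D D₀]
  have hMK : ∀ x, ‖modeOp κ (A x) (B x)‖ ≤ ‖A₀‖ + ρ + ‖κ‖ + (‖κ‖ + (‖B₀‖ + ρ)) := fun x => by
    linarith [norm_modeOp_le κ (A x) (B x), hbound (hAρ x), hbound (hBρ x)]
  have hMc : Continuous fun x => modeOp κ (A x) (B x) :=
    continuous_modeOp κ hAc hBc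
  have hN' : ∀ ξ ∈ N, ξ ≠ 0 → energy S ξ < 0 := fun ξ hξ hne => by
    obtain ⟨p, rfl⟩ := hN ξ hξ
    rw [neg_one_smul]
    exact hneg p fun hp => hne (by simp [hp])
  have hP' : ∀ ξ ∈ P, ξ ≠ 0 → 0 < energy S ξ := fun ξ hξ hne => by
    obtain ⟨p, rfl⟩ := hP ξ hξ
    rw [one_smul]
    exact hpos p fun hp => hne (by simp [hp])
  exact evans_dichotomy e hM hMc hMK hS hδ
    (fun x ξ => hE _ _ (hAρ x) (hBρ x) ξ) hN' hP' hNn hPn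

end Transfer

/-- Dimensions and transversality of the Evans fibres for `|κ| ≥ r`, uniformly near the reference
speed and state. -/
theorem exists_uniform_dichotomy {n : ℕ} {k : Fin n} {Ω : Set (Sp n)} (hΩ : IsOpen Ω)
    (h0 : (0 : Sp n) ∈ Ω) {f g : Sp n → Sp n} (hf : ContDiffOn ℝ ∞ f Ω) (hg : ContDiffOn ℝ ∞ g Ω)
    (hA : StandingAssumptions k Ω f g) {r : ℝ} (hr : 0 < r) :
    ∃ d > 0, ∀ s : ℝ, |s - charSpeed f g k 0| < d → ∀ φ : ℝ → Sp n, Continuous φ →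
      (∀ x, φ x ∈ Ω) → (∀ x, ‖φ x‖ < d) → ∀ κ : ℂ, 0 ≤ κ.re → r ≤ ‖κ‖ →
        Module.finrank ℂ (evansMinus f g s φ κ) = n ∧
        Module.finrank ℂ (evansPlus f g s φ κ) = n ∧
        evansMinus f g s φ κ ⊓ evansPlus f g s φ κ = ⊥ := by
  set s₀ := charSpeed f g k 0
  have hs₀ : |s₀| < 1 := abs_charSpeed_lt_one hA
  have hγ := gam_pos hs₀
  have hdf : ∀ v ∈ Ω, DifferentiableAt ℝ f v := fun v hv =>
    (hf.contDiffAt (hΩ.mem_nhds hv)).differentiableAt (by simp)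
  have hdg : ∀ v ∈ Ω, DifferentiableAt ℝ g v := fun v hv =>
    (hg.contDiffAt (hΩ.mem_nhds hv)).differentiableAt (by simp)
  have hcf : ∀ v ∈ Ω, ContinuousAt (jac f) v := fun v hv =>
    (continuousOn_jac hΩ hf).continuousAt (hΩ.mem_nhds hv)
  have hcg : ∀ v ∈ Ω, ContinuousAt (jac g) v := fun v hv =>
    (continuousOn_jac hΩ hg).continuousAt (hΩ.mem_nhds hv)
  obtain ⟨R, hR, hRpos, hRA⟩ := exists_inverse_of_posDef
    (hA.subchar_add.smul (mul_pos hγ (by linarith [(abs_lt.1 hs₀).2]) : 0 < gam s₀ * (1 - s₀)))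
  obtain ⟨T, hT, hTpos, hTA⟩ := exists_inverse_of_posDef
    (hA.subchar_sub.smul (mul_pos hγ (by linarith [(abs_lt.1 hs₀).1]) : 0 < gam s₀ * (1 + s₀)))
  rw [← boostedOp_add_boostedOp (jac f) (jac g)] at hRA
  rw [← boostedOp_sub_boostedOp (jac f) (jac g)] at hTA
  obtain ⟨ρ, hρ, δ, hδ, hlyap⟩ := exists_uniform_lyapunov hR hT hRpos hTpos hRA hTA hr
  obtain ⟨d₁, hd₁, hΦ⟩ := Metric.continuousAt_iff.1
    (continuousAt_boostedOp hs₀ (hcf 0 h0) (hcg 0 h0)) ρ hρ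
  obtain ⟨d₂, hd₂, hΓ⟩ := Metric.continuousAt_iff.1
    (continuousAt_boostedOp hs₀ (hcg 0 h0) (hcf 0 h0)) ρ hρ
  -- The bound 1 - |s₀| keeps |s| < 1, where `gam` is continuous; d₁ and d₂ keep both coefficients
  -- within ρ of their reference values.
  refine ⟨min (min d₁ d₂) (1 - |s₀|), lt_min (lt_min hd₁ hd₂) (by linarith), ?_⟩
  intro s hs φ hφ hφΩ hφd κ hκ hκr
  have hs1 : |s| < 1 := by
    have h1 := hs.trans_le (min_le_right _ _)
    have h2 := abs_sub_abs_le_abs_sub s s₀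
    linarith
  have hdist : ∀ x, dist (s, φ x) (s₀, (0 : Sp n)) < min d₁ d₂ := fun x => by
    rw [Prod.dist_eq, max_lt_iff, Real.dist_eq, dist_zero_right]
    exact ⟨hs.trans_le (min_le_left _ _), (hφd x).trans_le (min_le_left _ _)⟩
  have hΦx : ∀ x, ‖boostedOp (jac f) (jac g) (s, φ x) - boostedOp (jac f) (jac g) (s₀, 0)‖ ≤ ρ := fun x => by
    rw [← dist_eq_norm]
    exact (hΦ ((hdist x).trans_le (min_le_left _ _))).le
  have hΓx : ∀ x, ‖boostedOp (jac g) (jac f) (s, φ x) - boostedOp (jac g) (jac f) (s₀, 0)‖ ≤ ρ := fun x => by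
    rw [← dist_eq_norm]
    exact (hΓ ((hdist x).trans_le (min_le_right _ _))).le
  have hκ0 : κ ≠ 0 := norm_pos_iff.1 (hr.trans_le hκr)
  obtain ⟨S, hS, hpos, hneg, hE⟩ := hlyap κ hκ hκr
  have hM : ∀ x ξ, rescale hκ0 (modeMatrix f g s κ (φ x) *ᵥ ξ) =
      modeOp κ (boostedOp (jac f) (jac g) (s, φ x)) (boostedOp (jac g) (jac f) (s, φ x))
        (rescale hκ0 ξ) := fun x ξ => by
    rw [rescale_modeMatrix, jac_boostF (hdf _ (hφΩ x)) (hdg _ (hφΩ x)),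
      jac_boostG (hdf _ (hφΩ x)) (hdg _ (hφΩ x)), boostedOp, boostedOp]
  exact evans_dichotomy_of_near finrank_euclideanSpace_fin (rescale hκ0) hM
    (continuous_boostedOp_comp hs1 hcf hcg hφ hφΩ) (continuous_boostedOp_comp hs1 hcg hcf hφ hφΩ)
    hδ hΦx hΓx hS hpos hneg hE

end HypReg

theorem mainTheorem6 {n : ℕ} (k : Fin n) (hk : k.val = 0 ∨ k.val + 1 = n)
    (Ω : Set (HypReg.Sp n)) (hΩ : IsOpen Ω) (h0 : (0 : HypReg.Sp n) ∈ Ω)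
    (f g : HypReg.Sp n → HypReg.Sp n)
    (hf : ContDiffOn ℝ ∞ f Ω) (hg : ContDiffOn ℝ ∞ g Ω)
    (hA : HypReg.StandingAssumptions k Ω f g) (hN : HypReg.NormalCoordinates k f g)
    (ε₁ : ℝ) (hε₁ : 0 < ε₁) (hε₁' : ε₁ ≤ 1)
    (vm vp : ℝ → HypReg.Sp n) (s : ℝ → ℝ)
    (hS : HypReg.IsShockFamily k Ω f g ε₁ vm vp s)
    (r₁ : ℝ) (hr₁ : 0 < r₁) :
    ∃ ε₀ ∈ Set.Ioc 0 ε₁, ∀ ε ∈ Set.Ioc 0 ε₀, ∀ φ : ℝ → HypReg.Sp n,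
      HypReg.IsShockProfile Ω f g (vm ε) (vp ε) (s ε) φ → (∀ x, ‖φ x‖ ≤ 3 * ε) →
      ∀ ζ : ℂ, 0 ≤ ζ.re → r₁ ≤ ε ^ 2 * ‖ζ‖ →
        Module.finrank ℂ (HypReg.rescaledEvansMinus f g (s ε) φ ε ζ) = n ∧
        Module.finrank ℂ (HypReg.rescaledEvansPlus f g (s ε) φ ε ζ) = n ∧
        HypReg.rescaledEvansMinus f g (s ε) φ ε ζ ⊓
          HypReg.rescaledEvansPlus f g (s ε) φ ε ζ = ⊥ := by
  obtain ⟨d, hd, hdich⟩ := HypReg.exists_uniform_dichotomy hΩ h0 hf hg hA hr₁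
  obtain ⟨ε₂, hε₂, hs⟩ := Metric.continuousWithinAt_iff.1
    (hS.smooth_s.continuousOn 0 (left_mem_Icc.2 hε₁.le)) d hd
  -- ε ≤ ε₂/2 gives the strict inequality ε < ε₂ needed for the continuity of s at 0, and ε ≤ d/4
  -- gives ‖φ‖ ≤ 3ε < d.
  have hpos : 0 < min ε₁ (min (ε₂ / 2) (d / 4)) := by positivity
  refine ⟨min ε₁ (min (ε₂ / 2) (d / 4)), ⟨hpos, min_le_left _ _⟩, ?_⟩
  rintro ε ⟨hε, hεle⟩ φ hφ hφb ζ hζ hζr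
  obtain ⟨hle1, hle2, hle3⟩ : ε ≤ ε₁ ∧ ε ≤ ε₂ / 2 ∧ ε ≤ d / 4 := by
    simpa [le_min_iff] using hεle
  have hsε : |s ε - HypReg.charSpeed f g k 0| < d := by
    have := hs ⟨hε.le, hle1⟩ (by rw [Real.dist_eq, sub_zero, abs_of_pos hε]; linarith)
    rwa [Real.dist_eq, hS.speed_zero] at this
  refine hdich (s ε) hsε φ hφ.smooth.continuous hφ.mem (fun x => (hφb x).trans_lt (by linarith))
    ((ε : ℂ) ^ 2 * ζ) ?_ ?_
  · rw [← Complex.ofReal_pow, Complex.re_ofReal_mul]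
    positivity
  · rwa [norm_mul, norm_pow, Complex.norm_real, Real.norm_of_nonneg hε.le]
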